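/- **Conventions.** A Hackenbush position is a finite graph (loops and multiple edges allowed) with edges coloured blue, red or green and some vertices designated as the ground. Left and Right alternately cut an edge; Left may cut blue or green edges, Right red or green ones, and after each cut all edges no longer connected to the ground are removed. Under normal play a player unable to move loses; under misère play a player unable to move wins. The outcome is $\mathcal N$, $\mathcal P$, $\mathcal L$ or $\mathcal R$ according as the next player, the previous player, Left, or Right (whoever starts) can force a win; $o^+$ and $o^-$ denote the normal-play and misère-play outcomes. A Generalized Flower of height $h\ge 1$ is a green path of $h$ edges with its bottom end on the ground, supporting at its top end a Red-Blue Hackenbush position (no green edges), its blossom: all ground vertices of the blossom are identified with the top of the path. Its blossom value is the normal-play value of the blossom, i.e. the dyadic rational defined recursively as the simplest number strictly between the values of the left options and those of the right options (smallest denominator and, among integers, smallest absolute value). The flower is blue if this value is positive and red if it is negative; if it is $0$, the flower is treated as a Stalk of height $h$ (a Stalk in the strict sense is the case of an empty blossom). **Proposition 4.8.** Let $h\ge 2$, and let $F$ be the disjunctive sum of one blue Generalized Flower of height $h$ and blossom value $x_1>0$, one red Generalized Flower of height $h$ and blossom value $-y_1<0$, and finitely many (possibly no) Stalks, possibly carrying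 blossoms of value $0$, whose heights have nim-sum (bitwise exclusive or) $a$. Let $\alpha$ be the largest integer such that $2^\alpha\mid h$. Then $$o^+(F)=o^-(F)=\begin{cases}\mathcal N & \text{if } a\ge 2^\alpha,\text{ or } 0\ne a<2^\alpha \text{ and } x_1=y_1,\\ \mathcal P & \text{if } a=0 \text{ and } x_1=y_1,\\ \mathcal L & \text{if } a<2^\alpha \text{ and } x_1>y_1,\\ \mathcal R & \text{if } a<2^\alpha \text{ and } x_1<y_1.\end{cases}$$ -/

import Mathlib

/-! ### Combinatorial games, the two play conventions, and outcomes -/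

/-- The two players. -/
inductive Player where
  | left
  | right

/-- The opponent of a player. -/
def Player.other : Player → Player
  | .left => .right
  | .right => .left

/-- A game is given recursively by its left options and its right options: `moves p` indexes the
options of player `p`. -/
inductive CGame : Type 1 where
  | mk (moves : Player → Type) (option : (p : Player) → moves p → CGame) : CGame

/-- Player `p`, to move, wins under normal play (a player who cannot move loses). -/
def CGame.WinsNormal : CGame → Player → Prop
  | .mk moves option, p => ∃ i : moves p, ¬ (option p i).WinsNormal p.other

/-- Player `p`, to move, wins under misère play (a player who cannot move wins). -/
def CGame.WinsMisere : CGame → Player → Prop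
  | .mk moves option, p => IsEmpty (moves p) ∨ ∃ i : moves p, ¬ (option p i).WinsMisere p.other

/-- Outcome classes: next player wins, previous player wins, Left wins, Right wins. -/
inductive Outcome where
  | N
  | P
  | L
  | R

open Classical in
/-- The outcome class, when `wins p` says that player `p` wins if `p` is the first to move. -/
noncomputable def Outcome.ofWins (wins : Player → Prop) : Outcome :=
  if wins .left then (if wins .right then .N else .L)
  else (if wins .right then .R else .P)

/-- The outcome `o⁺` under normal play. -/
noncomputable def CGame.normalOutcome (G : CGame) : Outcome := Outcome.ofWins G.WinsNormal

/-- The outcome `o⁻` under misère play. -/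
noncomputable def CGame.misereOutcome (G : CGame) : Outcome := Outcome.ofWins G.WinsMisere

/-! ### Normal-play values -/

/-- `x` is a dyadic rational lying strictly between all of `S` and all of `T`. -/
def DyadicBetween (S T : Set ℚ) (x : ℚ) : Prop :=
  (∃ k : ℕ, x.den = 2 ^ k) ∧ (∀ s ∈ S, s < x) ∧ ∀ t ∈ T, x < t

/-- `x` is the simplest number between `S` and `T`: the dyadic rational strictly between them with
the smallest denominator and, among integers, the one of smallest absolute value. -/
def IsSimplestBetween (S T : Set ℚ) (x : ℚ) : Prop :=
  DyadicBetween S T x ∧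
    ∀ y, DyadicBetween S T y → x.den < y.den ∨ (x.den = y.den ∧ |x| ≤ |y|)

open Classical in
/-- The normal-play value of a game: recursively, the simplest number strictly between the values
of the left options and the values of the right options. (The default value `0` is only used when
there is no such number, which does not happen for Red-Blue Hackenbush positions.) -/
noncomputable def CGame.value : CGame → ℚ
  | .mk moves option =>
    if h : ∃ x, IsSimplestBetween (Set.range fun i : moves .left => (option .left i).value)
        (Set.range fun i : moves .right => (option .right i).value) x
    then h.choose else 0

/-! ### Hackenbush -/

/-- Edge colours. -/
inductive EdgeColor where
  | blue
  | red
  | green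

/-- Left may cut blue and green edges, Right may cut red and green edges. -/
def Player.CanCut : Player → EdgeColor → Prop
  | .left, c => c = .blue ∨ c = .green
  | .right, c => c = .red ∨ c = .green

/-- A Hackenbush position: a graph (loops and multiple edges are allowed) with finitely many
coloured edges and a set of vertices on the ground. -/
structure Hackenbush where
  /-- vertices -/
  V : Type
  /-- edges -/
  E : Type
  /-- there are finitely many edges -/
  finE : Fintype E
  /-- the two ends of an edge -/
  ends : E → Sym2 V
  /-- the colour of an edge -/
  color : E → EdgeColor
  /-- the vertices on the ground -/
  ground : Set V

namespace Hackenbush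

attribute [instance] Hackenbush.finE

/-- The vertices connected to the ground by a path of edges in `S`. -/
inductive Reached (G : Hackenbush) (S : Finset G.E) : G.V → Prop where
  | ground (v : G.V) (hv : v ∈ G.ground) : Reached G S v
  | step (e : G.E) (he : e ∈ S) (v w : G.V) (h : G.ends e = s(v, w)) (hv : Reached G S v) :
      Reached G S w

open Classical in
/-- What is left of the set of edges `S` when all edges not connected to the ground fall off. -/
noncomputable def grounded (G : Hackenbush) (S : Finset G.E) : Finset G.E :=
  S.filter fun e => ∃ v ∈ G.ends e, G.Reached S v

open Classical in
theorem card_grounded_erase_lt (G : Hackenbush) {S : Finset G.E} {e : G.E} (he : e ∈ S) :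
    (G.grounded (S.erase e)).card < S.card :=
  lt_of_le_of_lt (Finset.card_filter_le _ _) (Finset.card_erase_lt_of_mem he)

open Classical in
/-- The game played on `G` when the set of remaining edges is `S`: a player cuts one remaining edge
of a colour available to that player, and then all edges not connected to the ground are
removed. -/
noncomputable def gameOn (G : Hackenbush) (S : Finset G.E) : CGame :=
  .mk (fun p => {e : G.E // e ∈ S ∧ p.CanCut (G.color e)})
    fun _ e => G.gameOn (G.grounded (S.erase e.1))
termination_by S.card
decreasing_by exact G.card_grounded_erase_lt e.2.1

/-- The game of a Hackenbush position. -/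
noncomputable def game (G : Hackenbush) : CGame := G.gameOn (G.grounded Finset.univ)

/-- A Red-Blue Hackenbush position: there are no green edges. -/
def IsRedBlue (G : Hackenbush) : Prop := ∀ e, G.color e ≠ .green

/-- The empty position. -/
instance : Zero Hackenbush where
  zero :=
    { V := Empty
      E := Empty
      finE := inferInstance
      ends := Empty.elim
      color := Empty.elim
      ground := ∅ }

/-- The disjunctive sum: the disjoint union of the graphs and of their grounds. -/
instance : Add Hackenbush where
  add G H :=
    { V := G.V ⊕ H.V
      E := G.E ⊕ H.E
      finE := inferInstance
      ends := Sum.elim (fun e => (G.ends e).map Sum.inl) (fun e => (H.ends e).map Sum.inr)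
      color := Sum.elim G.color H.color
      ground := Sum.inl '' G.ground ∪ Sum.inr '' H.ground }

open Classical in
/-- A green path with `n` edges, its bottom end on the ground, that supports the position `B`:
all ground vertices of `B` are identified with the top end of the path. -/
noncomputable def stemWith (n : ℕ) (B : Hackenbush) : Hackenbush where
  V := Fin (n + 1) ⊕ B.V
  E := Fin n ⊕ B.E
  finE := inferInstance
  ends := Sum.elim (fun i => s(Sum.inl i.castSucc, Sum.inl i.succ))
    (fun e => (B.ends e).map fun v => if v ∈ B.ground then Sum.inl (Fin.last n) else Sum.inr v)
  color := Sum.elim (fun _ => .green) B.color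
  ground := {Sum.inl 0}

end Hackenbush

/-- A Generalized Flower: a green path of positive length (the stem, whose length is the height)
that supports a Red-Blue Hackenbush position (the blossom). A Stalk is the case of an empty
blossom. -/
structure GeneralizedFlower where
  /-- the length of the stem -/
  height : ℕ
  height_pos : 0 < height
  /-- the position supported by the stem -/
  blossom : Hackenbush
  blossom_redBlue : blossom.IsRedBlue

namespace GeneralizedFlower

/-- The Hackenbush position of a Generalized Flower. -/
noncomputable def position (f : GeneralizedFlower) : Hackenbush :=
  Hackenbush.stemWith f.height f.blossom

/-- The blossom value: the normal-play value of the blossom. The flower is blue if it is positive,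
red if it is negative, and it is treated as a Stalk if it is zero. -/
noncomputable def blossomValue (f : GeneralizedFlower) : ℚ := f.blossom.game.value

end GeneralizedFlower

/-- The nim-sum (bitwise exclusive or) of a list of natural numbers. -/
def nimSum (l : List ℕ) : ℕ := l.foldr (fun m n => m ^^^ n) 0

/-! Each Generalized Flower of height `n` gives an abstract game `flower n B`: either player may cut
the stem, leaving a nim heap `nim k` with `k < n`, or may move in the blossom game `B`. The
Hackenbush sum is bisimilar to a sum of such flowers. Bisimilarity preserves both outcomes, whereas
normal-play equality is only used for normal-play outcomes.

Blossoms are numbers: in a Red-Blue position cutting one's own edge never helps (`gameOn_cut_le`),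
so left values lie below right values, and both the order and the outcomes of sums are read off the
values (`Numeric.le_iff`, `Numeric.winsNormal_add_iff`).

Misère play reduces to normal play. When all heights are at most one, misère play agrees with normal
play after adding a stalk of height one (`winsMisere_flowers_iff_of_height_le_one`). A move that
destroys the last flower of height at least two can leave a stalk of height 0 or 1 at will
(`Step.exists_twin`), and this choice absorbs the extra stalk. As `h ≥ 2`, only normal play remains.

In normal play a flower with blossom value 0 equals a nim heap, so the position is `flower h X +
flower h Y + nim a`. If `a = 0`, stem cuts are answered by equal stem cuts, and the outcome is that
of `X + Y`, decided by `x - y`. If `a ≠ 0`, a player who is not behind wins moving first by removing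
the heap. A player who is behind can only hope to cut the opposing stem to some `k < h` with `k ^^^
a ≥ h`: the own flower then beats a heap at least as high as itself. If `k ^^^ a < h` the answer is
to cut the other stem to `k ^^^ a`, which leaves nim-sum zero. Writing `h = 2 ^ α * m` with `m` odd,
such a `k` exists exactly when `a ≥ 2 ^ α`. -/

namespace Player

@[simp] theorem other_other (p : Player) : p.other.other = p := by cases p <;> rfl

end Player

namespace CGame

/-! ### Options -/

/-- `Opt p G K` says that `K` is one of the options of player `p` in `G`. -/
def Opt (p : Player) : CGame → CGame → Prop
  | .mk m o, K => ∃ i : m p, o p i = K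

theorem induction_on_options {C : CGame → Prop}
    (h : ∀ G, (∀ p G', Opt p G G' → C G') → C G) (G : CGame) : C G := by
  induction G with
  | mk m o ih => exact h _ (by rintro p _ ⟨i, rfl⟩; exact ih p i)

theorem wellFounded_opt : WellFounded fun G' G : CGame => ∃ p, Opt p G G' :=
  ⟨fun G => induction_on_options (fun G ih => ⟨G, fun G' ⟨p, h⟩ => ih p G' h⟩) G⟩

instance : WellFoundedRelation CGame := ⟨_, wellFounded_opt⟩

theorem winsNormal_iff {G : CGame} {p : Player} :
    G.WinsNormal p ↔ ∃ G', Opt p G G' ∧ ¬ G'.WinsNormal p.other := by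
  cases G with
  | mk m o => simp [WinsNormal, Opt]

theorem winsMisere_iff {G : CGame} {p : Player} :
    G.WinsMisere p ↔ (¬ ∃ G', Opt p G G') ∨ ∃ G', Opt p G G' ∧ ¬ G'.WinsMisere p.other := by
  cases G with
  | mk m o => simp [WinsMisere, Opt]

instance : Zero CGame := ⟨.mk (fun _ => Empty) fun _ => Empty.elim⟩

@[simp] theorem not_opt_zero {p : Player} {K : CGame} : ¬ Opt p 0 K := by
  rintro ⟨i, -⟩
  exact i.elim

/-! ### The order -/

/-- The simultaneous recursion defining the order of games from the point of view of `p`: with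
`true` it says that `H` is at least as good as `G` for `p`, and with `false` that `G` is not at
least as good as `H`. -/
def Cmp (p : Player) : Bool → CGame → CGame → Prop
  | true, G, H =>
    (∀ G', Opt p G G' → Cmp p false G' H) ∧ ∀ H', Opt p.other H H' → Cmp p false G H'
  | false, G, H =>
    (∃ H', ∃ _ : Opt p H H', Cmp p true G H') ∨ ∃ G', ∃ _ : Opt p.other G G', Cmp p true G' H
termination_by _ G H => (G, H)
decreasing_by
  · exact Prod.Lex.left _ _ ⟨_, by assumption⟩
  · exact Prod.Lex.right _ ⟨_, by assumption⟩
  · exact Prod.Lex.right _ ⟨_, by assumption⟩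
  · exact Prod.Lex.left _ _ ⟨_, by assumption⟩

/-- `H` is at least as good as `G` for player `p` in normal play. -/
def Le (p : Player) (G H : CGame) : Prop := Cmp p true G H

/-- The Boolean in `Cmp` keeps the two games in a fixed order, so that the recursion descends
lexicographically. This lemma recovers the usual definition of the order, in which negation
exchanges the arguments; both orders of the arguments must therefore be treated together. -/
theorem cmp_false_iff (p : Player) (G H : CGame) :
    (Cmp p false G H ↔ ¬ Cmp p true H G) ∧ (Cmp p false H G ↔ ¬ Cmp p true G H) := by
  induction G using induction_on_options generalizing H with
  | h G ihG =>
    induction H using induction_on_options with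
    | h H ihH =>
      rw [Cmp, Cmp, Cmp, Cmp]
      constructor
      · rw [not_and_or]
        push Not
        refine or_congr (exists_congr fun H' => ?_) (exists_congr fun G' => ?_)
        · refine ⟨fun ⟨h, h'⟩ => ⟨h, ?_⟩, fun ⟨h, h'⟩ => ⟨h, ?_⟩⟩
          · rw [(ihH _ _ h).2]; simpa using h'
          · rw [(ihH _ _ h).2] at h'; simpa using h'
        · refine ⟨fun ⟨h, h'⟩ => ⟨h, ?_⟩, fun ⟨h, h'⟩ => ⟨h, ?_⟩⟩
          · rw [(ihG _ _ h H).2]; simpa using h'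
          · rw [(ihG _ _ h H).2] at h'; simpa using h'
      · rw [not_and_or]
        push Not
        refine or_congr (exists_congr fun H' => ?_) (exists_congr fun G' => ?_)
        · refine ⟨fun ⟨h, h'⟩ => ⟨h, ?_⟩, fun ⟨h, h'⟩ => ⟨h, ?_⟩⟩
          · rw [(ihG _ _ h H).1]; simpa using h'
          · rw [(ihG _ _ h H).1] at h'; simpa using h'
        · refine ⟨fun ⟨h, h'⟩ => ⟨h, ?_⟩, fun ⟨h, h'⟩ => ⟨h, ?_⟩⟩
          · rw [(ihH _ _ h).1]; simpa using h'
          · rw [(ihH _ _ h).1] at h'; simpa using h'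

theorem le_iff {p : Player} {G H : CGame} :
    Le p G H ↔ (∀ G', Opt p G G' → ¬ Le p H G') ∧ ∀ H', Opt p.other H H' → ¬ Le p H' G := by
  unfold Le
  rw [Cmp]
  simp only [(cmp_false_iff _ _ _).1]

theorem le_refl (p : Player) (G : CGame) : Le p G G := by
  induction G using induction_on_options with
  | h G ih =>
    exact le_iff.2 ⟨fun G' h h' => (le_iff.1 h').1 _ h (ih _ _ h),
      fun G' h h' => (le_iff.1 h').2 _ h (ih _ _ h)⟩

theorem not_le_of_opt {p : Player} {G G' : CGame} (h : Opt p G G') : ¬ Le p G G' :=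
  (le_iff.1 (le_refl p G)).1 _ h

theorem not_le_of_opt_other {p : Player} {G G' : CGame} (h : Opt p.other G G') : ¬ Le p G' G :=
  (le_iff.1 (le_refl p G)).2 _ h

/-- Passing to an option of one game rotates the roles of the three games, so the induction needs
all three cyclic forms of transitivity at once. -/
theorem le_trans_cyclic (p : Player) (G H K : CGame) :
    (Le p G H → Le p H K → Le p G K) ∧ (Le p H K → Le p K G → Le p H G) ∧
      (Le p K G → Le p G H → Le p K H) := by
  induction G using induction_on_options generalizing H K with
  | h G ihG =>
    induction H using induction_on_options generalizing K with
    | h H ihH =>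
      induction K using induction_on_options with
      | h K ihK =>
        refine ⟨fun h₁ h₂ => le_iff.2 ⟨fun X hX h => ?_, fun X hX h => ?_⟩,
          fun h₁ h₂ => le_iff.2 ⟨fun X hX h => ?_, fun X hX h => ?_⟩,
          fun h₁ h₂ => le_iff.2 ⟨fun X hX h => ?_, fun X hX h => ?_⟩⟩
        · exact (le_iff.1 h₁).1 X hX ((ihG _ _ hX _ _).2.1 h₂ h)
        · exact (le_iff.1 h₂).2 X hX ((ihK _ _ hX).2.2 h h₁)
        · exact (le_iff.1 h₁).1 X hX ((ihH _ _ hX _).2.2 h₂ h)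
        · exact (le_iff.1 h₂).2 X hX ((ihG _ _ hX _ _).1 h h₁)
        · exact (le_iff.1 h₁).1 X hX ((ihK _ _ hX).1 h₂ h)
        · exact (le_iff.1 h₂).2 X hX ((ihH _ _ hX _).2.1 h h₁)

theorem Le.trans {p : Player} {G H K : CGame} (h₁ : Le p G H) (h₂ : Le p H K) : Le p G K :=
  (le_trans_cyclic p G H K).1 h₁ h₂

theorem le_other_iff {p : Player} {G H : CGame} : Le p.other G H ↔ Le p H G := by
  suffices (Le p.other G H ↔ Le p H G) ∧ (Le p.other H G ↔ Le p G H) from this.1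
  induction G using induction_on_options generalizing H with
  | h G ihG =>
    induction H using induction_on_options with
    | h H ihH =>
      rw [@le_iff p.other, @le_iff p, @le_iff p.other, @le_iff p, Player.other_other]
      constructor
      · rw [and_comm]
        refine and_congr (forall₂_congr fun K hK => ?_) (forall₂_congr fun K hK => ?_)
        · rw [(ihH _ _ hK).2]
        · rw [(ihG _ _ hK).2]
      · rw [and_comm]
        refine and_congr (forall₂_congr fun K hK => ?_) (forall₂_congr fun K hK => ?_)
        · rw [(ihG _ _ hK).1]
        · rw [(ihH _ _ hK).1]

theorem winsNormal_iff_not_le {p : Player} {G : CGame} : G.WinsNormal p ↔ ¬ Le p G 0 := by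
  induction G using induction_on_options generalizing p with
  | h G ih =>
    rw [winsNormal_iff, le_iff]
    simp only [not_opt_zero, false_imp_iff, implies_true, and_true]
    push Not
    refine exists_congr fun G' => and_congr_right fun h => ?_
    rw [ih _ _ h, le_other_iff, not_not]

theorem winsNormal_other_iff_not_le {p : Player} {G : CGame} :
    G.WinsNormal p.other ↔ ¬ Le p 0 G := by
  rw [winsNormal_iff_not_le, le_other_iff]

theorem WinsNormal.mono {p : Player} {G H : CGame} (h : G.WinsNormal p) (hGH : Le p G H) :
    H.WinsNormal p := by
  rw [winsNormal_iff_not_le] at *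
  exact fun h' => h (hGH.trans h')

/-- Equality of games in normal play. -/
def Eqv (G H : CGame) : Prop := ∀ p, Le p G H

theorem Eqv.refl (G : CGame) : Eqv G G := fun p => le_refl p G

theorem Eqv.symm {G H : CGame} (h : Eqv G H) : Eqv H G := fun p => le_other_iff.1 (h p.other)

theorem Eqv.trans {G H K : CGame} (h : Eqv G H) (h' : Eqv H K) : Eqv G K :=
  fun p => (h p).trans (h' p)

theorem Eqv.winsNormal_iff {G H : CGame} (h : Eqv G H) {p : Player} :
    G.WinsNormal p ↔ H.WinsNormal p :=
  ⟨fun hG => hG.mono (h p), fun hH => hH.mono (h.symm p)⟩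

/-! ### Disjunctive sums -/

/-- The disjunctive sum of the game with the given moves and a second game, when the sums of its
options with other games are given. -/
def addAux (m : Player → Type) (f : (p : Player) → m p → CGame → CGame) : CGame → CGame
  | .mk n r => .mk (fun p => m p ⊕ n p) fun p =>
      Sum.elim (fun i => f p i (.mk n r)) fun j => addAux m f (r p j)

/-- The disjunctive sum of two games. -/
def add : CGame → CGame → CGame
  | .mk m o => addAux m fun p i => add (o p i)

instance : Add CGame := ⟨add⟩

theorem opt_add {p : Player} {G H K : CGame} :
    Opt p (G + H) K ↔ (∃ G', Opt p G G' ∧ K = G' + H) ∨ ∃ H', Opt p H H' ∧ K = G + H' := by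
  cases G with
  | mk m o =>
    cases H with
    | mk n r =>
      change (∃ i : m p ⊕ n p, _) ↔ _
      rw [Sum.exists]
      refine or_congr ⟨?_, ?_⟩ ⟨?_, ?_⟩
      · rintro ⟨i, rfl⟩
        exact ⟨_, ⟨i, rfl⟩, rfl⟩
      · rintro ⟨_, ⟨i, rfl⟩, rfl⟩
        exact ⟨i, rfl⟩
      · rintro ⟨i, rfl⟩
        exact ⟨_, ⟨i, rfl⟩, rfl⟩
      · rintro ⟨_, ⟨i, rfl⟩, rfl⟩
        exact ⟨i, rfl⟩

theorem Opt.add_right {p : Player} {G G' : CGame} (h : Opt p G G') (H : CGame) :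
    Opt p (G + H) (G' + H) := opt_add.2 (.inl ⟨_, h, rfl⟩)

theorem Opt.add_left {p : Player} {H H' : CGame} (h : Opt p H H') (G : CGame) :
    Opt p (G + H) (G + H') := opt_add.2 (.inr ⟨_, h, rfl⟩)

/-- Monotonicity and cancellation support each other, so negatives of games are not needed.
Cancellation for a pair uses monotonicity for its options, and conversely; a move in `K` is handled
by monotonicity for the smaller summand. -/
theorem add_le_add_right_iff {p : Player} {G H : CGame} (K : CGame) :
    Le p (G + K) (H + K) ↔ Le p G H := by
  suffices (Le p (G + K) (H + K) ↔ Le p G H) ∧ (Le p (H + K) (G + K) ↔ Le p H G) from this.1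
  induction G using induction_on_options generalizing H K with
  | h G ihG =>
    induction H using induction_on_options generalizing K with
    | h H ihH =>
      induction K using induction_on_options with
      | h K ihK =>
        refine ⟨⟨fun h => ?_, fun h => ?_⟩, ⟨fun h => ?_, fun h => ?_⟩⟩
        · refine le_iff.2 ⟨fun X hX h' => ?_, fun X hX h' => ?_⟩
          · exact not_le_of_opt (hX.add_right K) (h.trans ((ihG _ _ hX K).2.2 h'))
          · exact not_le_of_opt_other (hX.add_right K) (((ihH _ _ hX K).2.2 h').trans h)
        · refine le_iff.2 ⟨fun X hX h' => ?_, fun X hX h' => ?_⟩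
          · rcases opt_add.1 hX with ⟨Y, hY, rfl⟩ | ⟨Y, hY, rfl⟩
            · exact (le_iff.1 h).1 Y hY ((ihG _ _ hY K).2.1 h')
            · exact not_le_of_opt (hY.add_left H) (h'.trans ((ihK _ _ hY).1.2 h))
          · rcases opt_add.1 hX with ⟨Y, hY, rfl⟩ | ⟨Y, hY, rfl⟩
            · exact (le_iff.1 h).2 Y hY ((ihH _ _ hY K).2.1 h')
            · exact not_le_of_opt_other (hY.add_left G) (((ihK _ _ hY).1.2 h).trans h')
        · refine le_iff.2 ⟨fun X hX h' => ?_, fun X hX h' => ?_⟩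
          · exact not_le_of_opt (hX.add_right K) (h.trans ((ihH _ _ hX K).1.2 h'))
          · exact not_le_of_opt_other (hX.add_right K) (((ihG _ _ hX K).1.2 h').trans h)
        · refine le_iff.2 ⟨fun X hX h' => ?_, fun X hX h' => ?_⟩
          · rcases opt_add.1 hX with ⟨Y, hY, rfl⟩ | ⟨Y, hY, rfl⟩
            · exact (le_iff.1 h).1 Y hY ((ihH _ _ hY K).1.1 h')
            · exact not_le_of_opt (hY.add_left G) (h'.trans ((ihK _ _ hY).2.2 h))
          · rcases opt_add.1 hX with ⟨Y, hY, rfl⟩ | ⟨Y, hY, rfl⟩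
            · exact (le_iff.1 h).2 Y hY ((ihG _ _ hY K).1.1 h')
            · exact not_le_of_opt_other (hY.add_left H) (((ihK _ _ hY).2.2 h).trans h')

/-! ### Bisimilar games -/

/-- Two games are bisimilar if they have, recursively, the same options. -/
def Bisim : CGame → CGame → Prop
  | .mk m o, H => ∀ p, (∀ i : m p, ∃ H', Opt p H H' ∧ Bisim (o p i) H') ∧
      ∀ H', Opt p H H' → ∃ i : m p, Bisim (o p i) H'

theorem bisim_iff {G H : CGame} : Bisim G H ↔ ∀ p,
    (∀ G', Opt p G G' → ∃ H', Opt p H H' ∧ Bisim G' H') ∧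
      ∀ H', Opt p H H' → ∃ G', Opt p G G' ∧ Bisim G' H' := by
  cases G with
  | mk m o => simp [Bisim, Opt]

theorem Bisim.refl (G : CGame) : Bisim G G := by
  induction G using induction_on_options with
  | h G ih => exact bisim_iff.2 fun p => ⟨fun X h => ⟨X, h, ih _ _ h⟩, fun X h => ⟨X, h, ih _ _ h⟩⟩

theorem Bisim.symm {G H : CGame} (h : Bisim G H) : Bisim H G := by
  induction G using induction_on_options generalizing H with
  | h G ih =>
    rw [bisim_iff] at h ⊢
    refine fun p => ⟨fun X hX => ?_, fun X hX => ?_⟩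
    · obtain ⟨Y, hY, hXY⟩ := (h p).2 X hX
      exact ⟨Y, hY, ih _ _ hY hXY⟩
    · obtain ⟨Y, hY, hXY⟩ := (h p).1 X hX
      exact ⟨Y, hY, ih _ _ hX hXY⟩

theorem Bisim.trans {G H K : CGame} (h : Bisim G H) (h' : Bisim H K) : Bisim G K := by
  induction G using induction_on_options generalizing H K with
  | h G ih =>
    rw [bisim_iff] at h h' ⊢
    refine fun p => ⟨fun X hX => ?_, fun X hX => ?_⟩
    · obtain ⟨Y, hY, hXY⟩ := (h p).1 X hX
      obtain ⟨Z, hZ, hYZ⟩ := (h' p).1 Y hY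
      exact ⟨Z, hZ, ih _ _ hX hXY hYZ⟩
    · obtain ⟨Y, hY, hXY⟩ := (h' p).2 X hX
      obtain ⟨Z, hZ, hYZ⟩ := (h p).2 Y hY
      exact ⟨Z, hZ, ih _ _ hZ hYZ hXY⟩

theorem Bisim.winsNormal_iff {G H : CGame} (h : Bisim G H) {p : Player} :
    G.WinsNormal p ↔ H.WinsNormal p := by
  induction G using induction_on_options generalizing H p with
  | h G ih =>
    rw [bisim_iff] at h
    rw [CGame.winsNormal_iff, CGame.winsNormal_iff]
    constructor
    · rintro ⟨X, hX, hw⟩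
      obtain ⟨Y, hY, hXY⟩ := (h p).1 X hX
      exact ⟨Y, hY, by rwa [← ih _ _ hX hXY]⟩
    · rintro ⟨X, hX, hw⟩
      obtain ⟨Y, hY, hXY⟩ := (h p).2 X hX
      exact ⟨Y, hY, by rwa [ih _ _ hY hXY]⟩

/-- The reason for using bisimilarity beside `Eqv`: equality in normal play does not in general
preserve misère outcomes. -/
theorem Bisim.winsMisere_iff {G H : CGame} (h : Bisim G H) {p : Player} :
    G.WinsMisere p ↔ H.WinsMisere p := by
  induction G using induction_on_options generalizing H p with
  | h G ih =>
    rw [bisim_iff] at h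
    rw [CGame.winsMisere_iff, CGame.winsMisere_iff]
    refine or_congr (not_congr ⟨?_, ?_⟩) ⟨?_, ?_⟩
    · rintro ⟨X, hX⟩
      obtain ⟨Y, hY, -⟩ := (h p).1 X hX
      exact ⟨Y, hY⟩
    · rintro ⟨X, hX⟩
      obtain ⟨Y, hY, -⟩ := (h p).2 X hX
      exact ⟨Y, hY⟩
    · rintro ⟨X, hX, hw⟩
      obtain ⟨Y, hY, hXY⟩ := (h p).1 X hX
      exact ⟨Y, hY, by rwa [← ih _ _ hX hXY]⟩
    · rintro ⟨X, hX, hw⟩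
      obtain ⟨Y, hY, hXY⟩ := (h p).2 X hX
      exact ⟨Y, hY, by rwa [ih _ _ hY hXY]⟩

theorem Bisim.eqv {G H : CGame} (h : Bisim G H) : Eqv G H := by
  suffices ∀ p, Le p G H ∧ Le p H G from fun p => (this p).1
  intro p
  induction G using induction_on_options generalizing H with
  | h G ih =>
    rw [bisim_iff] at h
    refine ⟨le_iff.2 ⟨fun X hX h' => ?_, fun X hX h' => ?_⟩,
      le_iff.2 ⟨fun X hX h' => ?_, fun X hX h' => ?_⟩⟩
    · obtain ⟨Y, hY, hXY⟩ := (h _).1 X hX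
      exact not_le_of_opt hY (h'.trans (ih _ _ hX hXY).1)
    · obtain ⟨Y, hY, hXY⟩ := (h _).2 X hX
      exact not_le_of_opt_other hY ((ih _ _ hY hXY).1.trans h')
    · obtain ⟨Y, hY, hXY⟩ := (h _).2 X hX
      exact not_le_of_opt hY (h'.trans (ih _ _ hY hXY).2)
    · obtain ⟨Y, hY, hXY⟩ := (h _).1 X hX
      exact not_le_of_opt_other hY ((ih _ _ hX hXY).2.trans h')

theorem Bisim.add {G G' H H' : CGame} (hG : Bisim G G') (hH : Bisim H H') :
    Bisim (G + H) (G' + H') := by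
  induction G using induction_on_options generalizing G' H H' with
  | h G ihG =>
    induction H using induction_on_options generalizing H' with
    | h H ihH =>
      refine bisim_iff.2 fun p => ⟨fun X hX => ?_, fun X hX => ?_⟩
      · rcases opt_add.1 hX with ⟨Y, hY, rfl⟩ | ⟨Y, hY, rfl⟩
        · obtain ⟨Z, hZ, hYZ⟩ := (bisim_iff.1 hG p).1 Y hY
          exact ⟨_, hZ.add_right _, ihG _ _ hY hYZ hH⟩
        · obtain ⟨Z, hZ, hYZ⟩ := (bisim_iff.1 hH p).1 Y hY
          exact ⟨_, hZ.add_left _, ihH _ _ hY hYZ⟩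
      · rcases opt_add.1 hX with ⟨Y, hY, rfl⟩ | ⟨Y, hY, rfl⟩
        · obtain ⟨Z, hZ, hYZ⟩ := (bisim_iff.1 hG p).2 Y hY
          exact ⟨_, hZ.add_right _, ihG _ _ hZ hYZ hH⟩
        · obtain ⟨Z, hZ, hYZ⟩ := (bisim_iff.1 hH p).2 Y hY
          exact ⟨_, hZ.add_left _, ihH _ _ hZ hYZ⟩

theorem bisim_add_comm (G H : CGame) : Bisim (G + H) (H + G) := by
  induction G using induction_on_options generalizing H with
  | h G ihG =>
    induction H using induction_on_options with
    | h H ihH =>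
      refine bisim_iff.2 fun p => ⟨fun X hX => ?_, fun X hX => ?_⟩
      · rcases opt_add.1 hX with ⟨Y, hY, rfl⟩ | ⟨Y, hY, rfl⟩
        · exact ⟨_, hY.add_left _, ihG _ _ hY _⟩
        · exact ⟨_, hY.add_right _, ihH _ _ hY⟩
      · rcases opt_add.1 hX with ⟨Y, hY, rfl⟩ | ⟨Y, hY, rfl⟩
        · exact ⟨_, hY.add_left _, ihH _ _ hY⟩
        · exact ⟨_, hY.add_right _, ihG _ _ hY _⟩

theorem bisim_add_assoc (G H K : CGame) : Bisim (G + H + K) (G + (H + K)) := by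
  induction G using induction_on_options generalizing H K with
  | h G ihG =>
    induction H using induction_on_options generalizing K with
    | h H ihH =>
      induction K using induction_on_options with
      | h K ihK =>
        refine bisim_iff.2 fun p => ⟨fun X hX => ?_, fun X hX => ?_⟩
        · rcases opt_add.1 hX with ⟨Y, hY, rfl⟩ | ⟨Y, hY, rfl⟩
          · rcases opt_add.1 hY with ⟨Z, hZ, rfl⟩ | ⟨Z, hZ, rfl⟩
            · exact ⟨_, hZ.add_right _, ihG _ _ hZ _ _⟩
            · exact ⟨_, (hZ.add_right _).add_left _, ihH _ _ hZ _⟩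
          · exact ⟨_, (hY.add_left _).add_left _, ihK _ _ hY⟩
        · rcases opt_add.1 hX with ⟨Y, hY, rfl⟩ | ⟨Y, hY, rfl⟩
          · exact ⟨_, (hY.add_right _).add_right _, ihG _ _ hY _ _⟩
          · rcases opt_add.1 hY with ⟨Z, hZ, rfl⟩ | ⟨Z, hZ, rfl⟩
            · exact ⟨_, (hZ.add_left _).add_right _, ihH _ _ hZ _⟩
            · exact ⟨_, hZ.add_left _, ihK _ _ hZ⟩

theorem bisim_add_zero (G : CGame) : Bisim (G + 0) G := by
  induction G using induction_on_options with
  | h G ih =>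
    refine bisim_iff.2 fun p => ⟨fun X hX => ?_, fun X hX => ?_⟩
    · rcases opt_add.1 hX with ⟨Y, hY, rfl⟩ | ⟨Y, hY, rfl⟩
      · exact ⟨_, hY, ih _ _ hY⟩
      · exact absurd hY not_opt_zero
    · exact ⟨_, hX.add_right _, ih _ _ hX⟩

theorem eqv_add_comm (G H : CGame) : Eqv (G + H) (H + G) := (bisim_add_comm G H).eqv

theorem eqv_add_assoc (G H K : CGame) : Eqv (G + H + K) (G + (H + K)) := (bisim_add_assoc G H K).eqv

theorem eqv_add_zero (G : CGame) : Eqv (G + 0) G := (bisim_add_zero G).eqv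

theorem eqv_zero_add (G : CGame) : Eqv (0 + G) G := (eqv_add_comm 0 G).trans (eqv_add_zero G)

theorem Le.add {p : Player} {G G' H H' : CGame} (hG : Le p G G') (hH : Le p H H') :
    Le p (G + H) (G' + H') :=
  ((add_le_add_right_iff H).2 hG).trans ((eqv_add_comm _ _ p).trans
    (((add_le_add_right_iff G').2 hH).trans (eqv_add_comm _ _ p)))

theorem Eqv.add {G G' H H' : CGame} (hG : Eqv G G') (hH : Eqv H H') : Eqv (G + H) (G' + H') :=
  fun p => (hG p).add (hH p)

theorem eqv_add_left_comm (G H K : CGame) : Eqv (G + (H + K)) (H + (G + K)) :=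
  (eqv_add_assoc G H K).symm.trans
    (((eqv_add_comm G H).add (.refl K)).trans (eqv_add_assoc H G K))

end CGame

namespace CGame

/-! ### Nim heaps and flowers -/

/-- The ordinal sum whose base is an impartial game with the `n` options `f`. -/
def flowerOver (n : ℕ) (f : Fin n → CGame) : CGame → CGame
  | .mk m o => .mk (fun p => Fin n ⊕ m p) fun p => Sum.elim f fun i => flowerOver n f (o p i)

/-- The nim heap of size `n`. -/
def nim (n : ℕ) : CGame := flowerOver n (fun k => nim k) 0

/-- The flower of height `n` with blossom `B`. -/
def flower (n : ℕ) (B : CGame) : CGame := flowerOver n (fun k => nim k) B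

theorem flower_zero (n : ℕ) : flower n 0 = nim n := by rw [nim, flower]

theorem opt_flower {p : Player} {n : ℕ} {B K : CGame} : Opt p (flower n B) K ↔
    (∃ k < n, K = nim k) ∨ ∃ B', Opt p B B' ∧ K = flower n B' := by
  cases B with
  | mk m o =>
    change (∃ i : Fin n ⊕ m p, _) ↔ _
    rw [Sum.exists]
    refine or_congr ⟨?_, ?_⟩ ⟨?_, ?_⟩
    · rintro ⟨i, rfl⟩
      exact ⟨i, i.2, rfl⟩
    · rintro ⟨k, hk, rfl⟩
      exact ⟨⟨k, hk⟩, rfl⟩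
    · rintro ⟨i, rfl⟩
      exact ⟨_, ⟨i, rfl⟩, rfl⟩
    · rintro ⟨_, ⟨i, rfl⟩, rfl⟩
      exact ⟨i, rfl⟩

theorem opt_nim {p : Player} {n : ℕ} {K : CGame} : Opt p (nim n) K ↔ ∃ k < n, K = nim k := by
  rw [← flower_zero, opt_flower]
  simp

theorem opt_flower_cut (p : Player) {n k : ℕ} (B : CGame) (h : k < n) :
    Opt p (flower n B) (nim k) := opt_flower.2 (.inl ⟨k, h, rfl⟩)

theorem Opt.flower {p : Player} {B B' : CGame} (h : Opt p B B') (n : ℕ) :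
    Opt p (flower n B) (flower n B') := opt_flower.2 (.inr ⟨B', h, rfl⟩)

theorem opt_nim_of_lt (p : Player) {n k : ℕ} (h : k < n) : Opt p (nim n) (nim k) :=
  opt_nim.2 ⟨k, h, rfl⟩

theorem bisim_nim_zero : Bisim (nim 0) 0 := by
  refine bisim_iff.2 fun p => ⟨fun X hX => ?_, fun X hX => absurd hX not_opt_zero⟩
  obtain ⟨k, hk, -⟩ := opt_nim.1 hX
  omega

/-- Stem cuts do not affect the comparison, because both flowers offer the same cuts to both
players: a cut of one flower is also an option of the other and cannot violate the order. -/
theorem flower_le_flower_iff {p : Player} (n : ℕ) {B C : CGame} :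
    Le p (flower n B) (flower n C) ↔ Le p B C := by
  suffices (Le p (flower n B) (flower n C) ↔ Le p B C) ∧
    (Le p (flower n C) (flower n B) ↔ Le p C B) from this.1
  induction B using induction_on_options generalizing C with
  | h B ihB =>
    induction C using induction_on_options with
    | h C ihC =>
      refine ⟨⟨fun h => ?_, fun h => ?_⟩, ⟨fun h => ?_, fun h => ?_⟩⟩
      · refine le_iff.2 ⟨fun X hX h' => ?_, fun X hX h' => ?_⟩
        · exact not_le_of_opt (hX.flower n) (h.trans ((ihB _ _ hX).2.2 h'))
        · exact not_le_of_opt_other (hX.flower n) (((ihC _ _ hX).2.2 h').trans h)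
      · refine le_iff.2 ⟨fun X hX h' => ?_, fun X hX h' => ?_⟩
        · rcases opt_flower.1 hX with ⟨k, hk, rfl⟩ | ⟨Y, hY, rfl⟩
          · exact not_le_of_opt (opt_flower_cut p C hk) h'
          · exact (le_iff.1 h).1 Y hY ((ihB _ _ hY).2.1 h')
        · rcases opt_flower.1 hX with ⟨k, hk, rfl⟩ | ⟨Y, hY, rfl⟩
          · exact not_le_of_opt_other (opt_flower_cut _ B hk) h'
          · exact (le_iff.1 h).2 Y hY ((ihC _ _ hY).2.1 h')
      · refine le_iff.2 ⟨fun X hX h' => ?_, fun X hX h' => ?_⟩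
        · exact not_le_of_opt (hX.flower n) (h.trans ((ihC _ _ hX).1.2 h'))
        · exact not_le_of_opt_other (hX.flower n) (((ihB _ _ hX).1.2 h').trans h)
      · refine le_iff.2 ⟨fun X hX h' => ?_, fun X hX h' => ?_⟩
        · rcases opt_flower.1 hX with ⟨k, hk, rfl⟩ | ⟨Y, hY, rfl⟩
          · exact not_le_of_opt (opt_flower_cut p B hk) h'
          · exact (le_iff.1 h).1 Y hY ((ihC _ _ hY).1.1 h')
        · rcases opt_flower.1 hX with ⟨k, hk, rfl⟩ | ⟨Y, hY, rfl⟩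
          · exact not_le_of_opt_other (opt_flower_cut _ C hk) h'
          · exact (le_iff.1 h).2 Y hY ((ihB _ _ hY).1.1 h')

theorem nim_le_nim_iff {p : Player} {m n : ℕ} : Le p (nim m) (nim n) ↔ m = n := by
  refine ⟨fun h => ?_, fun h => h ▸ le_refl p _⟩
  rcases lt_trichotomy m n with hlt | heq | hlt
  · exact absurd h (not_le_of_opt_other (opt_nim_of_lt _ hlt))
  · exact heq
  · exact absurd h (not_le_of_opt (opt_nim_of_lt _ hlt))

/-- The options of the sum are nim heaps of sizes other than `a ^^^ b`, and every smaller size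
occurs among them. -/
theorem nim_add_nim (a b : ℕ) : Eqv (nim a + nim b) (nim (a ^^^ b)) := by
  induction a using Nat.strong_induction_on generalizing b with
  | _ a iha =>
    induction b using Nat.strong_induction_on with
    | _ b ihb =>
      have key : ∀ p K, Opt p (nim a + nim b) K → ∃ c, c ≠ a ^^^ b ∧ Eqv K (nim c) := by
        intro p K hK
        rcases opt_add.1 hK with ⟨Y, hY, rfl⟩ | ⟨Y, hY, rfl⟩
        · obtain ⟨k, hk, rfl⟩ := opt_nim.1 hY
          exact ⟨_, fun h => hk.ne (Nat.xor_left_inj.1 h), iha k hk b⟩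
        · obtain ⟨k, hk, rfl⟩ := opt_nim.1 hY
          exact ⟨_, fun h => hk.ne (Nat.xor_right_inj.1 h), ihb k hk⟩
      have key' : ∀ p K, Opt p (nim (a ^^^ b)) K → ∃ K', Opt p (nim a + nim b) K' ∧ Eqv K K' := by
        intro p K hK
        obtain ⟨c, hc, rfl⟩ := opt_nim.1 hK
        rcases Nat.lt_xor_cases hc with h | h
        · refine ⟨_, (opt_nim_of_lt p h).add_right _, ?_⟩
          have := iha _ h b
          rw [Nat.xor_assoc, Nat.xor_self, Nat.xor_zero] at this
          exact this.symm
        · refine ⟨_, (opt_nim_of_lt p h).add_left _, ?_⟩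
          have := ihb _ h
          rw [Nat.xor_left_comm, Nat.xor_self, Nat.xor_zero] at this
          exact this.symm
      intro p
      refine le_iff.2 ⟨fun X hX h => ?_, fun X hX h => ?_⟩
      · obtain ⟨c, hc, hXc⟩ := key _ _ hX
        exact hc (nim_le_nim_iff.1 (h.trans (hXc p))).symm
      · obtain ⟨K, hK, hXK⟩ := key' _ _ hX
        exact not_le_of_opt_other hK ((hXK.symm p).trans h)

theorem not_winsNormal_nim_add_self (a : ℕ) (p : Player) : ¬ (nim a + nim a).WinsNormal p := by
  have h := (nim_add_nim a a).trans ((Nat.xor_self a) ▸ bisim_nim_zero.eqv)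
  rw [h.winsNormal_iff, winsNormal_iff]
  simp

theorem winsNormal_of_opt {p : Player} {G G' : CGame} (h : Opt p G G')
    (h' : ¬ G'.WinsNormal p.other) : G.WinsNormal p := winsNormal_iff.2 ⟨G', h, h'⟩

/-- Cutting a stem to `k` loses: cutting the other stem to `k` leaves two equal nim heaps. Hence
only the moves in the blossoms count. -/
theorem winsNormal_flower_add_flower {p : Player} (n : ℕ) {X Y : CGame} :
    (flower n X + flower n Y).WinsNormal p ↔ (X + Y).WinsNormal p := by
  induction X using induction_on_options generalizing Y p with
  | h X ihX =>
    induction Y using induction_on_options generalizing p with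
    | h Y ihY =>
      constructor
      · intro h
        obtain ⟨K, hK, hw⟩ := winsNormal_iff.1 h
        rcases opt_add.1 hK with ⟨Z, hZ, rfl⟩ | ⟨Z, hZ, rfl⟩
        · rcases opt_flower.1 hZ with ⟨k, hk, rfl⟩ | ⟨W, hW, rfl⟩
          · exact absurd (winsNormal_of_opt ((opt_flower_cut _ Y hk).add_left _)
              (not_winsNormal_nim_add_self k _)) hw
          · rw [ihX _ _ hW] at hw
            exact winsNormal_of_opt (hW.add_right _) hw
        · rcases opt_flower.1 hZ with ⟨k, hk, rfl⟩ | ⟨W, hW, rfl⟩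
          · exact absurd (winsNormal_of_opt ((opt_flower_cut _ X hk).add_right _)
              (not_winsNormal_nim_add_self k _)) hw
          · rw [ihY _ _ hW] at hw
            exact winsNormal_of_opt (hW.add_left _) hw
      · intro h
        obtain ⟨K, hK, hw⟩ := winsNormal_iff.1 h
        rcases opt_add.1 hK with ⟨Z, hZ, rfl⟩ | ⟨Z, hZ, rfl⟩
        · rw [← ihX _ _ hZ] at hw
          exact winsNormal_of_opt ((hZ.flower n).add_right _) hw
        · rw [← ihY _ _ hZ] at hw
          exact winsNormal_of_opt ((hZ.flower n).add_left _) hw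

theorem winsNormal_flower_add_nim_self {p : Player} (n : ℕ) {X : CGame} :
    (flower n X + nim n).WinsNormal p ↔ X.WinsNormal p := by
  rw [← flower_zero, winsNormal_flower_add_flower, (eqv_add_zero X).winsNormal_iff]

/-- A flower that is good for `p` together with a nim heap that is at least as high is good for
`p`. -/
theorem not_winsNormal_flower_add_nim {p : Player} {X : CGame} (h₁ : X.WinsNormal p)
    (h₂ : ¬ X.WinsNormal p.other) (h₃ : ∀ X', Opt p.other X X' → ¬ X'.WinsNormal p.other)
    {n b : ℕ} (hb : n ≤ b) : ¬ (flower n X + nim b).WinsNormal p.other := by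
  rcases hb.eq_or_lt with rfl | hlt
  · rwa [winsNormal_flower_add_nim_self]
  intro h
  obtain ⟨K, hK, hw⟩ := winsNormal_iff.1 h
  rw [Player.other_other] at hw
  refine hw ?_
  -- Replies for `p` when the heap exceeds `n`: copy a stem cut in the heap, answer a blossom move
  -- by lowering the heap to `n`, and answer a heap move by equalising the stem or the heap. If the
  -- heap has just become `n`, `p` moves first in what amounts to `X`.
  rcases opt_add.1 hK with ⟨Z, hZ, rfl⟩ | ⟨Z, hZ, rfl⟩
  · rcases opt_flower.1 hZ with ⟨k, hk, rfl⟩ | ⟨W, hW, rfl⟩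
    · exact winsNormal_of_opt ((opt_nim_of_lt _ (hk.trans hlt)).add_left _)
        (not_winsNormal_nim_add_self k _)
    · refine winsNormal_of_opt ((opt_nim_of_lt _ hlt).add_left _) ?_
      rw [winsNormal_flower_add_nim_self]
      exact h₃ _ hW
  · obtain ⟨k, hk, rfl⟩ := opt_nim.1 hZ
    rcases lt_trichotomy k n with hkn | rfl | hkn
    · exact winsNormal_of_opt ((opt_flower_cut _ _ hkn).add_right _)
        (not_winsNormal_nim_add_self k _)
    · rwa [winsNormal_flower_add_nim_self]
    · refine winsNormal_of_opt ((opt_nim_of_lt _ hkn).add_left _) ?_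
      rwa [winsNormal_flower_add_nim_self]

/-! ### Sums of flowers -/

/-- The disjunctive sum of the flowers with given heights and blossoms. -/
def flowers (L : List (ℕ × CGame)) : CGame := L.foldr (fun c G => flower c.1 c.2 + G) 0

@[simp] theorem flowers_cons (c : ℕ × CGame) (L : List (ℕ × CGame)) :
    flowers (c :: L) = flower c.1 c.2 + flowers L := rfl

/-- Replacing each blossom by 0 can only hurt `p`, and what remains is a sum of nim heaps. -/
theorem nim_le_flowers {p : Player} {L : List (ℕ × CGame)} (h : ∀ c ∈ L, Le p 0 c.2) :
    Le p (nim (nimSum (L.map Prod.fst))) (flowers L) := by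
  induction L with
  | nil => exact bisim_nim_zero.eqv p
  | cons c L ih =>
    have h₁ : Le p (nim c.1) (flower c.1 c.2) := by
      rw [← flower_zero, flower_le_flower_iff]
      exact h c List.mem_cons_self
    exact ((nim_add_nim _ _).symm p).trans (h₁.add (ih fun d hd => h d (List.mem_cons_of_mem _ hd)))

/-- The moves of player `p` in a sum of flowers. -/
inductive Step (p : Player) : List (ℕ × CGame) → List (ℕ × CGame) → Prop
  | cut {n k : ℕ} (B : CGame) (L : List (ℕ × CGame)) (h : k < n) :
      Step p ((n, B) :: L) ((k, 0) :: L)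
  | blossom {B B' : CGame} (n : ℕ) (L : List (ℕ × CGame)) (h : Opt p B B') :
      Step p ((n, B) :: L) ((n, B') :: L)
  | tail (c : ℕ × CGame) {L L' : List (ℕ × CGame)} (h : Step p L L') : Step p (c :: L) (c :: L')

theorem opt_flowers {p : Player} {L : List (ℕ × CGame)} {K : CGame} :
    Opt p (flowers L) K ↔ ∃ L', Step p L L' ∧ K = flowers L' := by
  constructor
  · intro h
    induction L generalizing K with
    | nil => exact absurd h not_opt_zero
    | cons c L ih =>
      rcases opt_add.1 h with ⟨Z, hZ, rfl⟩ | ⟨Z, hZ, rfl⟩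
      · rcases opt_flower.1 hZ with ⟨k, hk, rfl⟩ | ⟨W, hW, rfl⟩
        · exact ⟨_, .cut c.2 L hk, by rw [flowers_cons, flower_zero]; rfl⟩
        · exact ⟨_, .blossom c.1 L hW, rfl⟩
      · obtain ⟨L', hL', rfl⟩ := ih hZ
        exact ⟨_, .tail c hL', rfl⟩
  · rintro ⟨L', h, rfl⟩
    induction h with
    | cut B L h =>
      rw [flowers_cons, flowers_cons, flower_zero]
      exact (opt_flower_cut p B h).add_right _
    | blossom n L h => exact (h.flower n).add_right _
    | tail c _ ih => exact ih.add_left _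

theorem winsNormal_flowers_iff {p : Player} {L : List (ℕ × CGame)} : (flowers L).WinsNormal p ↔
    ∃ L', Step p L L' ∧ ¬ (flowers L').WinsNormal p.other := by
  rw [winsNormal_iff]
  constructor
  · rintro ⟨K, hK, hw⟩
    obtain ⟨L', hL', rfl⟩ := opt_flowers.1 hK
    exact ⟨L', hL', hw⟩
  · rintro ⟨L', hL', hw⟩
    exact ⟨_, opt_flowers.2 ⟨L', hL', rfl⟩, hw⟩

theorem winsMisere_flowers_iff {p : Player} {L : List (ℕ × CGame)} : (flowers L).WinsMisere p ↔
    (¬ ∃ L', Step p L L') ∨ ∃ L', Step p L L' ∧ ¬ (flowers L').WinsMisere p.other := by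
  rw [winsMisere_iff]
  refine or_congr (not_congr ⟨?_, ?_⟩) ⟨?_, ?_⟩
  · rintro ⟨K, hK⟩
    obtain ⟨L', hL', rfl⟩ := opt_flowers.1 hK
    exact ⟨L', hL'⟩
  · rintro ⟨L', hL'⟩
    exact ⟨_, opt_flowers.2 ⟨L', hL', rfl⟩⟩
  · rintro ⟨K, hK, hw⟩
    obtain ⟨L', hL', rfl⟩ := opt_flowers.1 hK
    exact ⟨L', hL', hw⟩
  · rintro ⟨L', hL', hw⟩
    exact ⟨_, opt_flowers.2 ⟨L', hL', rfl⟩, hw⟩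

end CGame

/-! ### Simplest numbers -/

theorem exists_dyadic_between {b c : ℚ} (h : b < c) :
    ∃ x : ℚ, (∃ k : ℕ, x.den = 2 ^ k) ∧ b < x ∧ x < c := by
  obtain ⟨k, hk⟩ := pow_unbounded_of_one_lt (1 / (c - b)) (one_lt_two (α := ℚ))
  have h2 : (0 : ℚ) < 2 ^ k := by positivity
  rw [div_lt_iff₀ (sub_pos.2 h)] at hk
  have h1 := Int.lt_floor_add_one (b * 2 ^ k)
  have h3 := Int.floor_le (b * 2 ^ k)
  -- The first multiple of `1 / 2 ^ k` beyond `b`; it lies below `c` since `1 / 2 ^ k < c - b`.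
  refine ⟨((⌊b * 2 ^ k⌋ + 1 : ℤ) : ℚ) / ((2 ^ k : ℤ) : ℚ), ?_, ?_, ?_⟩
  · have h4 := Rat.den_dvd (⌊b * 2 ^ k⌋ + 1) (2 ^ k)
    rw [Rat.divInt_eq_div] at h4
    obtain ⟨m, -, hm⟩ := (Nat.dvd_prime_pow Nat.prime_two).1 (Int.natCast_dvd_natCast.1
      (h4.trans (by push_cast; exact dvd_rfl : (2 ^ k : ℤ) ∣ ((2 ^ k : ℕ) : ℤ))))
    exact ⟨m, hm⟩
  · push_cast
    rw [lt_div_iff₀ h2]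
    exact h1
  · push_cast
    rw [div_lt_iff₀ h2]
    nlinarith

theorem Rat.abs_le_abs_of_natAbs_num_le {x y : ℚ} (hd : x.den = y.den)
    (h : x.num.natAbs ≤ y.num.natAbs) : |x| ≤ |y| := by
  rw [Rat.abs_def, Rat.abs_def, Rat.divInt_eq_div, Rat.divInt_eq_div, hd]
  gcongr

theorem exists_isSimplestBetween {S T : Set ℚ} (hS : S.Finite) (hT : T.Finite)
    (h : ∀ s ∈ S, ∀ t ∈ T, s < t) : ∃ x, IsSimplestBetween S T x := by
  obtain ⟨b, hb, hb'⟩ := hS.exists_between' hT h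
  obtain ⟨c, hc, hc'⟩ := (Set.finite_singleton b).exists_between' hT (by simpa using hb')
  obtain ⟨x, hx, hbx, hxc⟩ := exists_dyadic_between (hc b rfl)
  have hne : {z | DyadicBetween S T z}.Nonempty :=
    ⟨x, hx, fun s hs => (hb s hs).trans hbx, fun t ht => hxc.trans (hc' t ht)⟩
  -- Simplicity is minimality of the denominator and then of the absolute numerator, a well-founded
  -- lexicographic order on all of `ℚ`.
  have wf : WellFounded (InvImage (Prod.Lex (· < ·) (· < ·))
      fun z : ℚ => (z.den, z.num.natAbs)) :=
    InvImage.wf _ (WellFounded.prod_lex wellFounded_lt wellFounded_lt)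
  obtain ⟨z, hz, hmin⟩ := wf.has_min _ hne
  refine ⟨z, hz, fun y hy => ?_⟩
  have := hmin y hy
  simp only [InvImage, Prod.lex_def, not_or, not_and, not_lt] at this
  rcases this.1.lt_or_eq with h | h
  · exact .inl h
  · exact .inr ⟨h, Rat.abs_le_abs_of_natAbs_num_le h (this.2 h.symm)⟩

/-- `x` is the simplest dyadic rational in `P`. -/
def IsSimplestIn (P : Set ℚ) (x : ℚ) : Prop :=
  x ∈ P ∧ (∃ k : ℕ, x.den = 2 ^ k) ∧
    ∀ y ∈ P, (∃ k : ℕ, y.den = 2 ^ k) → x.den < y.den ∨ (x.den = y.den ∧ |x| ≤ |y|)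

/-- Each of the two is at least as simple as the other, so they agree up to sign. If the signs
differ, convexity of `P` puts 0 into `P`, and 0 is simpler than any other number. -/
theorem IsSimplestIn.eq {P Q : Set ℚ} [P.OrdConnected] {x y : ℚ} (hx : IsSimplestIn P x)
    (hy : IsSimplestIn Q y) (hxQ : x ∈ Q) (hyP : y ∈ P) : x = y := by
  have h₁ := hx.2.2 y hyP hy.2.1
  have h₂ := hy.2.2 x hxQ hx.2.1
  rcases h₁ with h₁ | ⟨hd, h₁⟩
  · rcases h₂ with h₂ | ⟨hd, h₂⟩ <;> omega
  rcases h₂ with h₂ | ⟨-, h₂⟩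
  · omega
  rcases abs_eq_abs.1 (h₁.antisymm h₂) with h | h
  · exact h
  have h0 : (0 : ℚ) ∈ P := by
    rcases le_total x 0 with h' | h'
    · exact Set.OrdConnected.out ‹_› hx.1 hyP ⟨h', by linarith⟩
    · exact Set.OrdConnected.out ‹_› hyP hx.1 ⟨by linarith, h'⟩
  have hx0 : x = 0 := by
    rcases hx.2.2 0 h0 ⟨0, rfl⟩ with h' | ⟨-, h'⟩
    · have := x.den_pos
      rw [Rat.den_zero] at h'
      omega
    · simpa using h'
  rw [hx0] at h ⊢
  linarith

namespace CGame

/-! ### Numeric games -/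

theorem value_spec {G : CGame}
    (h : ∃ x, IsSimplestBetween {v | ∃ G', Opt .left G G' ∧ G'.value = v}
      {v | ∃ G', Opt .right G G' ∧ G'.value = v} x) :
    IsSimplestBetween {v | ∃ G', Opt .left G G' ∧ G'.value = v}
      {v | ∃ G', Opt .right G G' ∧ G'.value = v} G.value := by
  cases G with
  | mk m o =>
    have key : ∀ p, {v | ∃ G', Opt p (mk m o) G' ∧ G'.value = v} =
        Set.range fun i : m p => (o p i).value := by
      intro p
      ext v
      simp [Opt]
    rw [key, key] at h ⊢
    rw [value, dif_pos h]
    exact h.choose_spec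

/-- A game is numeric if, hereditarily, its value lies strictly between the values of its left and
of its right options. -/
inductive Numeric : CGame → Prop
  | intro (G : CGame)
      (h : IsSimplestBetween {v | ∃ G', Opt .left G G' ∧ G'.value = v}
        {v | ∃ G', Opt .right G G' ∧ G'.value = v} G.value)
      (h' : ∀ p G', Opt p G G' → Numeric G') : Numeric G

theorem Numeric.opt {p : Player} {G G' : CGame} (h : Numeric G) (h' : Opt p G G') : Numeric G' := by
  cases h with
  | intro _ _ h => exact h _ _ h'

/-- The value of a game, from the point of view of a player. -/
noncomputable def valueFor (p : Player) (G : CGame) : ℚ :=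
  match p with
  | .left => G.value
  | .right => -G.value

@[simp] theorem valueFor_other (p : Player) (G : CGame) : valueFor p.other G = -valueFor p G := by
  cases p <;> simp [valueFor, Player.other]

/-- The interval between the values of the options of the two players. -/
def gap (p : Player) (G : CGame) : Set ℚ :=
  {z | (∀ G', Opt p G G' → valueFor p G' < z) ∧ ∀ G', Opt p.other G G' → z < valueFor p G'}

instance ordConnected_gap (p : Player) (G : CGame) : (gap p G).OrdConnected :=
  ⟨fun _ hx _ hy _ hz => ⟨fun G' h => (hx.1 G' h).trans_le hz.1,
    fun G' h => hz.2.trans_lt (hy.2 G' h)⟩⟩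

theorem neg_mem_gap_other {p : Player} {G : CGame} {z : ℚ} :
    -z ∈ gap p.other G ↔ z ∈ gap p G := by
  simp only [gap, Set.mem_ofPred_eq, Player.other_other, valueFor_other, neg_lt_neg_iff]
  exact and_comm

theorem Numeric.isSimplestIn {G : CGame} (h : Numeric G) (p : Player) :
    IsSimplestIn (gap p G) (valueFor p G) := by
  have hl : IsSimplestIn (gap .left G) (valueFor .left G) := by
    obtain ⟨_, ⟨⟨hd, hl, hr⟩, hs⟩, -⟩ := h
    refine ⟨⟨fun G' h => hl _ ⟨G', h, rfl⟩, fun G' h => hr _ ⟨G', h, rfl⟩⟩, hd, fun y hy hk => ?_⟩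
    refine hs y ⟨hk, ?_, ?_⟩
    · rintro _ ⟨G', h, rfl⟩
      exact hy.1 G' h
    · rintro _ ⟨G', h, rfl⟩
      exact hy.2 G' h
  cases p with
  | left => exact hl
  | right =>
    refine ⟨neg_mem_gap_other.2 hl.1, hl.2.1, fun y hy hk => ?_⟩
    have := hl.2.2 (-y) (neg_mem_gap_other.1 (by simpa [Player.other] using hy)) hk
    rw [abs_neg] at this
    rw [valueFor, abs_neg]
    exact this

theorem Numeric.valueFor_lt {p : Player} {G G' : CGame} (h : Numeric G) (h' : Opt p G G') :
    valueFor p G' < valueFor p G := (h.isSimplestIn p).1.1 G' h'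

theorem Numeric.lt_valueFor {p : Player} {G G' : CGame} (h : Numeric G) (h' : Opt p.other G G') :
    valueFor p G < valueFor p G' := (h.isSimplestIn p).1.2 G' h'

/-- By induction the recursive order says that the options of each game lie on the correct side of
the value of the other game. If the values were nevertheless in the wrong order, each would lie in
the gap of the other game, and two simplest numbers in this situation coincide. -/
theorem Numeric.le_iff {p : Player} {G H : CGame} (hG : Numeric G) (hH : Numeric H) :
    Le p G H ↔ valueFor p G ≤ valueFor p H := by
  suffices (Le p G H ↔ valueFor p G ≤ valueFor p H) ∧ (Le p H G ↔ valueFor p H ≤ valueFor p G)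
    from this.1
  induction G using induction_on_options generalizing H with
  | h G ihG =>
    induction H using induction_on_options with
    | h H ihH =>
      have key : ∀ {A B : CGame}, Numeric A → Numeric B →
          ((∀ A', Opt p A A' → valueFor p A' < valueFor p B) ∧
            (∀ B', Opt p.other B B' → valueFor p A < valueFor p B') ↔
              valueFor p A ≤ valueFor p B) := by
        intro A B hA hB
        refine ⟨fun ⟨h₁, h₂⟩ => ?_, fun h => ⟨fun A' h' => (hA.valueFor_lt h').trans_le h,
          fun B' h' => h.trans_lt (hB.lt_valueFor h')⟩⟩
        by_contra hlt
        rw [not_le] at hlt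
        refine hlt.ne' ((hA.isSimplestIn p).eq (hB.isSimplestIn p)
          ⟨fun B' h' => (hB.valueFor_lt h').trans hlt, h₂⟩
          ⟨h₁, fun A' h' => hlt.trans (hA.lt_valueFor h')⟩)
      constructor
      · rw [← key hG hH, CGame.le_iff]
        refine and_congr (forall₂_congr fun K hK => ?_) (forall₂_congr fun K hK => ?_)
        · rw [(ihG _ _ hK (hG.opt hK) hH).2, not_le]
        · rw [(ihH _ _ hK (hH.opt hK)).2, not_le]
      · rw [← key hH hG, CGame.le_iff]
        refine and_congr (forall₂_congr fun K hK => ?_) (forall₂_congr fun K hK => ?_)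
        · rw [(ihH _ _ hK (hH.opt hK)).1, not_le]
        · rw [(ihG _ _ hK (hG.opt hK) hH).1, not_le]

theorem Numeric.winsNormal_add_iff {p : Player} {G H : CGame} (hG : Numeric G) (hH : Numeric H) :
    (G + H).WinsNormal p ↔ 0 < valueFor p G + valueFor p H := by
  induction G using induction_on_options generalizing p H with
  | h G ihG =>
    induction H using induction_on_options generalizing p with
    | h H ihH =>
      have h₁ : ∀ G', Opt p G G' →
          (¬ (G' + H).WinsNormal p.other ↔ 0 ≤ valueFor p G' + valueFor p H) := by
        intro G' h
        rw [ihG _ _ h (hG.opt h) hH, valueFor_other, valueFor_other, not_lt]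
        constructor <;> intro <;> linarith
      have h₂ : ∀ H', Opt p H H' →
          (¬ (G + H').WinsNormal p.other ↔ 0 ≤ valueFor p G + valueFor p H') := by
        intro H' h
        rw [ihH _ _ h (hH.opt h), valueFor_other, valueFor_other, not_lt]
        constructor <;> intro <;> linarith
      rw [winsNormal_iff]
      constructor
      · rintro ⟨K, hK, hw⟩
        rcases opt_add.1 hK with ⟨Z, hZ, rfl⟩ | ⟨Z, hZ, rfl⟩
        · rw [h₁ _ hZ] at hw
          linarith [hG.valueFor_lt hZ]
        · rw [h₂ _ hZ] at hw
          linarith [hH.valueFor_lt hZ]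
      · intro hpos
        by_contra hno
        have h₃ : ∀ G', Opt p G G' → valueFor p G' < -valueFor p H := by
          intro G' h
          by_contra hle
          exact hno ⟨_, h.add_right H, (h₁ _ h).2 (by linarith)⟩
        have h₄ : ∀ H', Opt p H H' → valueFor p H' < -valueFor p G := by
          intro H' h
          by_contra hle
          exact hno ⟨_, h.add_left G, (h₂ _ h).2 (by linarith)⟩
        -- If no move keeps the sum nonnegative, then `G` and the negative of `H` have values in
        -- each other's gap. The values therefore agree, and the sum is 0 rather than positive.
        have h₅ : -valueFor p H ∈ gap p G :=
          ⟨h₃, fun G' h => by linarith [hG.lt_valueFor h]⟩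
        have h₆ : valueFor p G ∈ gap p.other H := by
          rw [← neg_neg (valueFor p G), neg_mem_gap_other]
          exact ⟨h₄, fun H' h => by linarith [hH.lt_valueFor h]⟩
        have := (hG.isSimplestIn p).eq (hH.isSimplestIn p.other) h₆ (by simpa using h₅)
        rw [valueFor_other] at this
        linarith

theorem numeric_zero : Numeric 0 :=
  .intro _ (value_spec (exists_isSimplestBetween (by simp) (by simp) (by simp))) (by simp)

@[simp] theorem value_zero : (0 : CGame).value = 0 := by
  have := (numeric_zero.isSimplestIn .left).2.2 0 (by simp [gap]) ⟨0, rfl⟩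
  rcases this with h | ⟨-, h⟩
  · have := (valueFor .left 0).den_pos
    rw [Rat.den_zero] at h
    omega
  · simpa [valueFor] using h

@[simp] theorem valueFor_zero (p : Player) : valueFor p 0 = 0 := by
  cases p <;> simp [valueFor]

theorem Numeric.winsNormal_iff {p : Player} {G : CGame} (hG : Numeric G) :
    G.WinsNormal p ↔ 0 < valueFor p G := by
  rw [winsNormal_iff_not_le, hG.le_iff numeric_zero, valueFor_zero, not_le]

theorem Numeric.winsNormal_other_iff {p : Player} {G : CGame} (hG : Numeric G) :
    G.WinsNormal p.other ↔ valueFor p G < 0 := by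
  rw [hG.winsNormal_iff, valueFor_other, neg_pos]

end CGame

namespace CGame

/-! ### Misère play of sums of flowers -/

/-- All blossoms are numeric, and only flowers of positive height carry a blossom. -/
def IsFlowerList (L : List (ℕ × CGame)) : Prop :=
  ∀ c ∈ L, Numeric c.2 ∧ (c.1 = 0 → ∀ p B, ¬ Opt p c.2 B)

theorem isFlowerList_cons {c : ℕ × CGame} {L : List (ℕ × CGame)} : IsFlowerList (c :: L) ↔
    (Numeric c.2 ∧ (c.1 = 0 → ∀ p B, ¬ Opt p c.2 B)) ∧ IsFlowerList L :=
  List.forall_mem_cons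

theorem Step.isFlowerList {p : Player} {L L' : List (ℕ × CGame)} (h : Step p L L')
    (hL : IsFlowerList L) : IsFlowerList L' := by
  induction h with
  | cut B L h =>
    exact isFlowerList_cons.2 ⟨⟨numeric_zero, fun _ _ _ => not_opt_zero⟩,
      (isFlowerList_cons.1 hL).2⟩
  | blossom n L h =>
    have := isFlowerList_cons.1 hL
    exact isFlowerList_cons.2 ⟨⟨this.1.1.opt h, fun h0 => absurd h (this.1.2 h0 _ _)⟩, this.2⟩
  | tail c _ ih =>
    have := isFlowerList_cons.1 hL
    exact isFlowerList_cons.2 ⟨this.1, ih this.2⟩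

theorem Step.forall_height_le {p : Player} {L L' : List (ℕ × CGame)} (h : Step p L L') {m : ℕ}
    (hL : ∀ c ∈ L, c.1 ≤ m) : ∀ c ∈ L', c.1 ≤ m := by
  induction h with
  | cut B L h =>
    rw [List.forall_mem_cons] at hL ⊢
    exact ⟨h.le.trans hL.1, hL.2⟩
  | blossom n L h =>
    rw [List.forall_mem_cons] at hL ⊢
    exact hL
  | tail c _ ih =>
    rw [List.forall_mem_cons] at hL ⊢
    exact ⟨hL.1, ih hL.2⟩

theorem exists_step_of_pos (p : Player) {L : List (ℕ × CGame)} {c : ℕ × CGame} (hc : c ∈ L)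
    (hpos : 0 < c.1) : ∃ L', Step p L L' := by
  induction L with
  | nil => simp at hc
  | cons d L ih =>
    rcases List.mem_cons.1 hc with rfl | h
    · exact ⟨_, .cut c.2 L hpos⟩
    · obtain ⟨L', hL'⟩ := ih h
      exact ⟨_, .tail d hL'⟩

/-- Here it matters that a flower of height zero has a blossom without options: play ends exactly
when all heights are zero. -/
theorem Step.exists_pos {p : Player} {L L' : List (ℕ × CGame)} (h : Step p L L')
    (hL : IsFlowerList L) : ∃ c ∈ L, 0 < c.1 := by
  induction h with
  | cut B L h => exact ⟨_, List.mem_cons_self, Nat.zero_lt_of_lt h⟩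
  | blossom n L h =>
    exact ⟨_, List.mem_cons_self, Nat.pos_of_ne_zero fun h0 =>
      (isFlowerList_cons.1 hL).1.2 h0 _ _ h⟩
  | tail c _ ih =>
    obtain ⟨d, hd, hpos⟩ := ih (isFlowerList_cons.1 hL).2
    exact ⟨d, List.mem_cons_of_mem _ hd, hpos⟩

theorem eqv_flower_zero_add (G : CGame) : Eqv (flower 0 0 + G) G := by
  rw [flower_zero]
  exact (bisim_nim_zero.eqv.add (.refl G)).trans (eqv_zero_add G)

/-- Cutting such a flower to the ground while adding a stalk of height one amounts to replacing its
blossom by 0, which cannot hurt `p`. -/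
theorem exists_step_flowers_le {p : Player} {L : List (ℕ × CGame)} {c : ℕ × CGame} (hc : c ∈ L)
    (h₁ : c.1 = 1) (h : Le p c.2 0) :
    ∃ L', Step p L L' ∧ Le p (flowers L) (flowers ((1, 0) :: L')) := by
  induction L with
  | nil => simp at hc
  | cons d L ih =>
    rcases List.mem_cons.1 hc with rfl | hc
    · refine ⟨_, .cut c.2 L (k := 0) (by omega), ?_⟩
      simp only [flowers_cons, h₁]
      exact ((flower_le_flower_iff 1).2 h).add ((eqv_flower_zero_add _).symm p)
    · obtain ⟨L', hL', hle⟩ := ih hc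
      refine ⟨_, .tail d hL', ?_⟩
      simp only [flowers_cons] at hle ⊢
      exact ((le_refl p _).add hle).trans (eqv_add_left_comm _ _ _ p)

theorem exists_step_nimSum_of_height_one {p : Player} {L : List (ℕ × CGame)} {c : ℕ × CGame}
    (hc : c ∈ L) (h₁ : c.1 = 1) (hL : ∀ d ∈ L, Le p 0 d.2) :
    ∃ L', Step p L L' ∧ 1 ^^^ nimSum (L'.map Prod.fst) = nimSum (L.map Prod.fst) ∧
      ∀ d ∈ L', Le p 0 d.2 := by
  induction L with
  | nil => simp at hc
  | cons d L ih =>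
    rw [List.forall_mem_cons] at hL
    rcases List.mem_cons.1 hc with rfl | hc
    · refine ⟨_, .cut c.2 L (k := 0) (by omega), ?_, ?_⟩
      · simp [nimSum, h₁]
      · rw [List.forall_mem_cons]
        exact ⟨le_refl p 0, hL.2⟩
    · obtain ⟨L', hL', heq, hle⟩ := ih hc hL.2
      refine ⟨_, .tail d hL', ?_, ?_⟩
      · rw [List.map_cons, List.map_cons]
        change 1 ^^^ (d.1 ^^^ nimSum _) = d.1 ^^^ nimSum _
        rw [Nat.xor_left_comm, heq]
      · rw [List.forall_mem_cons]
        exact ⟨hL.1, hle⟩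

/-- A winning first move inside the blossom leaves a blossom that is still nonnegative for `p`, and
it does not disturb the nim-sum of the heights. -/
theorem exists_step_blossom {p : Player} {L : List (ℕ × CGame)} {c : ℕ × CGame}
    (hc : c ∈ L) (h₁ : c.2.WinsNormal p) (hL : ∀ d ∈ L, Le p 0 d.2) :
    ∃ L', Step p L L' ∧ L'.map Prod.fst = L.map Prod.fst ∧ ∀ d ∈ L', Le p 0 d.2 := by
  induction L with
  | nil => simp at hc
  | cons d L ih =>
    rw [List.forall_mem_cons] at hL
    rcases List.mem_cons.1 hc with rfl | hc
    · obtain ⟨B, hB, hw⟩ := winsNormal_iff.1 h₁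
      refine ⟨_, .blossom c.1 L hB, by simp, ?_⟩
      rw [List.forall_mem_cons]
      rw [winsNormal_other_iff_not_le, not_not] at hw
      exact ⟨hw, hL.2⟩
    · obtain ⟨L', hL', heq, hle⟩ := ih hc hL.2
      refine ⟨_, .tail d hL', by simp [heq], ?_⟩
      rw [List.forall_mem_cons]
      exact ⟨hL.1, hle⟩

theorem nimSum_lt_two {l : List ℕ} (h : ∀ n ∈ l, n ≤ 1) : nimSum l < 2 := by
  induction l with
  | nil => simp [nimSum]
  | cons n l ih =>
    rw [List.forall_mem_cons] at h
    exact Nat.xor_lt_two_pow (n := 1) (by omega) (ih h.2)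

/-- If `p` wins a nonempty sum of flowers of height at most one when moving second, then `p` also
has a move to a position which, with an additional stalk of height one, `p` wins when moving
second. -/
theorem exists_step_of_le_flowers {p : Player} {L : List (ℕ × CGame)} (hL : IsFlowerList L)
    (h₁ : ∀ c ∈ L, c.1 ≤ 1) (hpos : ∃ c ∈ L, 0 < c.1) (hle : Le p 0 (flowers L)) :
    ∃ L', Step p L L' ∧ Le p 0 (flowers ((1, 0) :: L')) := by
  by_cases hex : ∃ c ∈ L, c.1 = 1 ∧ Le p c.2 0
  · obtain ⟨c, hc, hc1, hc2⟩ := hex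
    obtain ⟨L', hL', h⟩ := exists_step_flowers_le hc hc1 hc2
    exact ⟨L', hL', hle.trans h⟩
  -- Otherwise every blossom on a stem of height one is strictly positive for `p`, because numbers
  -- are totally ordered.
  push Not at hex
  have hall : ∀ d ∈ L, Le p 0 d.2 := by
    intro d hd
    by_cases h0 : d.1 = 0
    · exact CGame.le_iff.2 ⟨fun X hX => absurd hX not_opt_zero,
        fun X hX => absurd hX ((hL d hd).2 h0 _ _)⟩
    · have h' := hex d hd (by have := h₁ d hd; omega)
      rw [(hL d hd).1.le_iff numeric_zero, not_le] at h'
      exact (numeric_zero.le_iff (hL d hd).1).2 h'.le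
  obtain ⟨c, hc, hcpos⟩ := hpos
  have hc1 : c.1 = 1 := by have := h₁ c hc; omega
  have hlt := nimSum_lt_two (l := L.map Prod.fst) (by simpa using h₁)
  have hfin : ∀ L' : List (ℕ × CGame), 1 ^^^ nimSum (L'.map Prod.fst) = 0 →
      (∀ d ∈ L', Le p 0 d.2) → Le p 0 (flowers ((1, 0) :: L')) := by
    intro L' h0 hL'
    have := nim_le_flowers (p := p) (L := (1, 0) :: L')
      (by rw [List.forall_mem_cons]; exact ⟨le_refl p 0, hL'⟩)
    have h0' : nimSum (((1, 0) :: L').map Prod.fst) = 0 := h0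
    rw [h0'] at this
    exact (bisim_nim_zero.eqv.symm p).trans this
  -- The nim-sum of the heights after the move has to be 1, so that the extra stalk cancels it. A
  -- stem cut changes the parity, a blossom move preserves it.
  rcases (by omega : nimSum (L.map Prod.fst) = 0 ∨ nimSum (L.map Prod.fst) = 1) with h | h
  · obtain ⟨L', hL', heq, hle'⟩ := exists_step_nimSum_of_height_one hc hc1 hall
    exact ⟨L', hL', hfin L' (heq.trans h) hle'⟩
  · obtain ⟨L', hL', heq, hle'⟩ :=
      exists_step_blossom hc (winsNormal_iff_not_le.2 (hex c hc hc1)) hall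
    exact ⟨L', hL', hfin L' (by rw [heq, h]; rfl) hle'⟩

theorem not_winsNormal_flowers_of_height_zero {p : Player} {L : List (ℕ × CGame)}
    (hL : IsFlowerList L) (h : ¬ ∃ c ∈ L, 0 < c.1) : ¬ (flowers L).WinsNormal p := by
  rw [winsNormal_flowers_iff]
  rintro ⟨L', hL', -⟩
  exact h (hL'.exists_pos hL)

/-- The added stalk is a spare move, available to either player. If play in `L` is over, the mover
takes the stalk and wins, as in misère play. If taking it wins earlier, `exists_step_of_le_flowers`
supplies a winning move in `L` that keeps the stalk. -/
theorem winsMisere_flowers_iff_of_height_le_one {p : Player} {L : List (ℕ × CGame)}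
    (hL : IsFlowerList L) (h₁ : ∀ c ∈ L, c.1 ≤ 1) :
    (flowers L).WinsMisere p ↔ (flowers ((1, 0) :: L)).WinsNormal p := by
  induction hG : flowers L using induction_on_options generalizing L p with
  | h G ih =>
    subst hG
    have ih' : ∀ L', Step p L L' → ((flowers L').WinsMisere p.other ↔
        (flowers ((1, 0) :: L')).WinsNormal p.other) := fun L' h =>
      ih _ _ (opt_flowers.2 ⟨L', h, rfl⟩) (h.isFlowerList hL) (h.forall_height_le h₁) rfl
    rw [winsMisere_flowers_iff]
    constructor
    · rintro (h | ⟨L', hL', hw⟩)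
      · refine winsNormal_flowers_iff.2 ⟨_, .cut 0 L zero_lt_one, ?_⟩
        rw [flowers_cons, (eqv_flower_zero_add _).winsNormal_iff]
        refine not_winsNormal_flowers_of_height_zero hL ?_
        rintro ⟨c, hc, hpos⟩
        exact h (exists_step_of_pos p hc hpos)
      · rw [ih' L' hL'] at hw
        exact winsNormal_flowers_iff.2 ⟨_, .tail _ hL', hw⟩
    · intro h
      by_cases hpos : ∃ c ∈ L, 0 < c.1
      · right
        obtain ⟨L', hL', hw⟩ := winsNormal_flowers_iff.1 h
        cases hL' with
        | @cut _ k _ _ hk =>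
          obtain rfl : k = 0 := by omega
          rw [flowers_cons, (eqv_flower_zero_add _).winsNormal_iff, winsNormal_other_iff_not_le,
            not_not] at hw
          obtain ⟨L', hL', hw'⟩ := exists_step_of_le_flowers hL h₁ hpos hw
          refine ⟨L', hL', ?_⟩
          rw [ih' L' hL', winsNormal_other_iff_not_le, not_not]
          exact hw'
        | blossom _ _ h => exact absurd h not_opt_zero
        | tail _ h => exact ⟨_, h, by rwa [ih' _ h]⟩
      · left
        rintro ⟨L', hL'⟩
        exact hpos (hL'.exists_pos hL)

/-- If a move destroys the last flower of height at least two, then there is another move that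
leaves the same position up to a stalk of height one. -/
theorem Step.exists_twin {p : Player} {L L' : List (ℕ × CGame)} (h : Step p L L')
    (hL : ¬ ∀ c ∈ L, c.1 ≤ 1) (hL' : ∀ c ∈ L', c.1 ≤ 1) :
    ∃ L'', Step p L L'' ∧ (∀ c ∈ L'', c.1 ≤ 1) ∧ Eqv (flowers ((1, 0) :: L')) (flowers L'') ∧
      Eqv (flowers ((1, 0) :: L'')) (flowers L') := by
  induction h with
  | @cut n k B L h =>
    rw [List.forall_mem_cons] at hL hL'
    have hk : k = 0 ∨ k = 1 := by have := hL'.1; omega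
    have hn : 1 < n := by
      by_contra hn
      exact hL ⟨not_lt.1 hn, hL'.2⟩
    -- As `1 < n`, the stem can be cut to 0 as well as to 1, and adding a stalk of height one
    -- interchanges the two results.
    have key : ∀ k : ℕ, k = 0 ∨ k = 1 →
        Eqv (flower 1 0 + (flower k 0 + flowers L)) (flower (1 - k) 0 + flowers L) := by
      intro k hk
      refine (eqv_add_assoc _ _ _).symm.trans (Eqv.add ?_ (.refl _))
      rw [flower_zero, flower_zero, flower_zero]
      rcases hk with rfl | rfl
      · exact nim_add_nim 1 0
      · exact nim_add_nim 1 1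
    refine ⟨(1 - k, 0) :: L, .cut B L (by omega), ?_, key k hk, ?_⟩
    · rw [List.forall_mem_cons]
      exact ⟨Nat.sub_le _ _, hL'.2⟩
    · have := key (1 - k) (by omega)
      rwa [(by omega : 1 - (1 - k) = k)] at this
  | blossom n L h =>
    rw [List.forall_mem_cons] at hL hL'
    exact absurd hL' hL
  | @tail c L L' h ih =>
    rw [List.forall_mem_cons] at hL hL'
    obtain ⟨L'', h₁, h₂, h₃, h₄⟩ := ih (fun h => hL ⟨hL'.1, h⟩) hL'.2
    refine ⟨_, .tail c h₁, ?_, ?_, ?_⟩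
    · rw [List.forall_mem_cons]
      exact ⟨hL'.1, h₂⟩
    · exact (eqv_add_left_comm _ _ _).trans ((Eqv.refl _).add h₃)
    · exact (eqv_add_left_comm _ _ _).trans ((Eqv.refl _).add h₄)

/-- If some flower has height at least two, then the outcome is the same under both play
conventions. -/
theorem winsMisere_flowers_iff_winsNormal {p : Player} {L : List (ℕ × CGame)}
    (hL : IsFlowerList L) (h₁ : ¬ ∀ c ∈ L, c.1 ≤ 1) :
    (flowers L).WinsMisere p ↔ (flowers L).WinsNormal p := by
  induction hG : flowers L using induction_on_options generalizing L p with
  | h G ih =>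
    subst hG
    rw [winsMisere_flowers_iff, winsNormal_flowers_iff]
    constructor
    · rintro (h | ⟨L', hL', hw⟩)
      · push Not at h₁
        obtain ⟨c, hc, h2⟩ := h₁
        exact absurd (exists_step_of_pos p hc (by omega)) h
      -- If only heights at most one remain, misère play of `L'` is normal play with an extra stalk,
      -- which is normal play of the twin `L''`.
      · by_cases h' : ∀ c ∈ L', c.1 ≤ 1
        · rw [winsMisere_flowers_iff_of_height_le_one (hL'.isFlowerList hL) h'] at hw
          obtain ⟨L'', hL'', -, heq, -⟩ := hL'.exists_twin h₁ h'
          exact ⟨L'', hL'', by rwa [← heq.winsNormal_iff]⟩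
        · rw [ih _ _ (opt_flowers.2 ⟨L', hL', rfl⟩) (hL'.isFlowerList hL) h' rfl] at hw
          exact ⟨L', hL', hw⟩
    · rintro ⟨L', hL', hw⟩
      right
      by_cases h' : ∀ c ∈ L', c.1 ≤ 1
      · obtain ⟨L'', hL'', h'', -, heq⟩ := hL'.exists_twin h₁ h'
        refine ⟨L'', hL'', ?_⟩
        rwa [winsMisere_flowers_iff_of_height_le_one (hL''.isFlowerList hL) h'',
          heq.winsNormal_iff]
      · exact ⟨L', hL', by
          rwa [ih _ _ (opt_flowers.2 ⟨L', hL', rfl⟩) (hL'.isFlowerList hL) h' rfl]⟩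

end CGame

/-! ### Which player may cut which colour -/

theorem Player.CanCut.not_other {p : Player} {c : EdgeColor} (h : p.CanCut c) (hc : c ≠ .green) :
    ¬ p.other.CanCut c := by
  cases p <;> cases c <;> simp_all [Player.CanCut, Player.other]

theorem Player.canCut_green (p : Player) : p.CanCut .green := by
  cases p <;> simp [Player.CanCut]

namespace Hackenbush

open CGame

variable {G H : Hackenbush}

/-! ### Cutting edges -/

theorem Reached.mono {S T : Finset G.E} (h : S ⊆ T) {v : G.V} (hv : G.Reached S v) :
    G.Reached T v := by
  induction hv with
  | ground v hv => exact .ground v hv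
  | step e he v w h' _ ih => exact .step e (h he) v w h' ih

theorem mem_grounded {S : Finset G.E} {e : G.E} :
    e ∈ G.grounded S ↔ e ∈ S ∧ ∃ v ∈ G.ends e, G.Reached S v := by
  classical
  simp [grounded]

theorem grounded_subset (S : Finset G.E) : G.grounded S ⊆ S := fun _ h => (mem_grounded.1 h).1

theorem Reached.of_grounded {S T U : Finset G.E} (hST : S ⊆ T)
    (hU : ∀ e ∈ S, e ∈ G.grounded T → e ∈ U) {v : G.V} (hv : G.Reached S v) : G.Reached U v := by
  induction hv with
  | ground v hv => exact .ground v hv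
  | step e he v w h' hv ih =>
    exact .step e (hU e he (mem_grounded.2 ⟨hST he, v, by simp [h'], hv.mono hST⟩)) v w h' ih

theorem grounded_eq_of_subset {S U : Finset G.E} (hU : U ⊆ S)
    (h : ∀ e ∈ S, (∃ v ∈ G.ends e, G.Reached S v) → e ∈ U) : G.grounded U = G.grounded S := by
  have key : ∀ v, G.Reached S v → G.Reached U v := fun v hv =>
    hv.of_grounded (Finset.Subset.refl S) fun e he he' => h e he (mem_grounded.1 he').2
  ext e
  rw [mem_grounded, mem_grounded]
  constructor
  · rintro ⟨he, v, hv, hr⟩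
    exact ⟨hU he, v, hv, hr.mono hU⟩
  · rintro ⟨he, v, hv, hr⟩
    exact ⟨h e he ⟨v, hv, hr⟩, v, hv, key v hr⟩

@[simp] theorem grounded_grounded (S : Finset G.E) : G.grounded (G.grounded S) = G.grounded S :=
  grounded_eq_of_subset (grounded_subset S) fun _ he h => mem_grounded.2 ⟨he, h⟩

open Classical in
/-- What is left of the set of edges `S` after cutting the edge `e`. -/
noncomputable def cut (G : Hackenbush) (S : Finset G.E) (e : G.E) : Finset G.E :=
  G.grounded (S.erase e)

theorem opt_gameOn {p : Player} {S : Finset G.E} {K : CGame} :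
    Opt p (G.gameOn S) K ↔ ∃ e ∈ S, p.CanCut (G.color e) ∧ K = G.gameOn (G.cut S e) := by
  rw [gameOn]
  constructor
  · rintro ⟨⟨e, he, hc⟩, rfl⟩
    exact ⟨e, he, hc, rfl⟩
  · rintro ⟨e, he, hc, rfl⟩
    exact ⟨⟨e, he, hc⟩, rfl⟩

@[simp] theorem grounded_cut (S : Finset G.E) (e : G.E) : G.grounded (G.cut S e) = G.cut S e :=
  grounded_grounded _

theorem cut_subset (S : Finset G.E) (e : G.E) : G.cut S e ⊆ S := by
  classical
  exact (grounded_subset _).trans (Finset.erase_subset e S)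

theorem card_cut_lt {S : Finset G.E} {e : G.E} (he : e ∈ S) : (G.cut S e).card < S.card :=
  G.card_grounded_erase_lt he

theorem cut_eq_self {S : Finset G.E} {e : G.E} (hS : G.grounded S = S) (he : e ∉ S) :
    G.cut S e = S := by
  classical
  rw [cut, Finset.erase_eq_of_notMem he, hS]

open Classical in
-- Edges that have fallen off after the first cut do not connect anything to the ground, so falling
-- may be postponed until both cuts are made.
theorem cut_cut (S : Finset G.E) (e f : G.E) :
    G.cut (G.cut S e) f = G.grounded ((S.erase e).erase f) := by
  refine grounded_eq_of_subset (Finset.erase_subset_erase f (grounded_subset _)) ?_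
  rintro g hg ⟨v, hv, hr⟩
  rw [Finset.mem_erase] at hg ⊢
  exact ⟨hg.1, mem_grounded.2 ⟨hg.2, v, hv, hr.mono (Finset.erase_subset f _)⟩⟩

theorem cut_comm (S : Finset G.E) (e f : G.E) : G.cut (G.cut S e) f = G.cut (G.cut S f) e := by
  classical
  rw [cut_cut, cut_cut, Finset.erase_right_comm]

/-- Two edges cannot each depend on the other for support. On a path from the ground to `e`,
whichever of `e` and `f` is met first is reached without using either, and so survives the removal
of the other. -/
theorem mem_cut_or_mem_cut {S : Finset G.E} (hS : G.grounded S = S) {e f : G.E} (he : e ∈ S)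
    (hf : f ∈ S) (hef : e ≠ f) : e ∈ G.cut S f ∨ f ∈ G.cut S e := by
  classical
  set T := (S.erase e).erase f with hT
  have key : ∀ v, G.Reached S v → G.Reached T v ∨
      (∃ w ∈ G.ends e, G.Reached T w) ∨ ∃ w ∈ G.ends f, G.Reached T w := by
    intro v hv
    induction hv with
    | ground v hv => exact .inl (.ground v hv)
    | step g hg v w h _ ih =>
      rcases ih with ih | ih
      · by_cases hge : g = e
        · exact .inr (.inl ⟨v, by simp [← hge, h], ih⟩)
        by_cases hgf : g = f
        · exact .inr (.inr ⟨v, by simp [← hgf, h], ih⟩)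
        exact .inl (.step g (by simp [hT, hge, hgf, hg]) v w h ih)
      · exact .inr ih
  have hTe : T ⊆ S.erase e := Finset.erase_subset _ _
  have hTf : T ⊆ S.erase f := by
    rw [hT, Finset.erase_right_comm]
    exact Finset.erase_subset _ _
  have h₁ : (∃ w ∈ G.ends e, G.Reached T w) → e ∈ G.cut S f := fun ⟨w, hw, hr⟩ =>
    mem_grounded.2 ⟨Finset.mem_erase.2 ⟨hef, he⟩, w, hw, hr.mono hTf⟩
  have h₂ : (∃ w ∈ G.ends f, G.Reached T w) → f ∈ G.cut S e := fun ⟨w, hw, hr⟩ =>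
    mem_grounded.2 ⟨Finset.mem_erase.2 ⟨hef.symm, hf⟩, w, hw, hr.mono hTe⟩
  rw [← hS] at he
  obtain ⟨-, v, hv, hr⟩ := mem_grounded.1 he
  rcases key v hr with h | h | h
  · exact .inl (h₁ ⟨v, hv, h⟩)
  · exact .inl (h₁ h)
  · exact .inr (h₂ h)

/-! ### Red-Blue positions are numeric -/

/-- In a Red-Blue position, cutting one of one's own edges is disadvantageous. -/
theorem gameOn_cut_le (hG : G.IsRedBlue) {p : Player} {S : Finset G.E} (hS : G.grounded S = S)
    {e : G.E} (he : e ∈ S) (hc : p.CanCut (G.color e)) :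
    Le p (G.gameOn (G.cut S e)) (G.gameOn S) := by
  induction hn : S.card using Nat.strong_induction_on generalizing S with
  | _ n ih =>
    subst hn
    have ih' : ∀ f ∈ S, Le p (G.gameOn (G.cut (G.cut S e) f)) (G.gameOn (G.cut S f)) := by
      intro f hf
      rw [cut_comm]
      by_cases hef : e ∈ G.cut S f
      · exact ih _ (card_cut_lt hf) (grounded_cut S f) hef rfl
      · rw [cut_eq_self (grounded_cut S f) hef]
        exact le_refl p _
    refine CGame.le_iff.2 ⟨fun X hX h => ?_, fun X hX h => ?_⟩
    · obtain ⟨f, hf, hfc, rfl⟩ := opt_gameOn.1 hX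
      have hfS := cut_subset S e hf
      exact not_le_of_opt (opt_gameOn.2 ⟨f, hfS, hfc, rfl⟩) (h.trans (ih' f hfS))
    · obtain ⟨f, hf, hfc, rfl⟩ := opt_gameOn.1 hX
      by_cases hfe : f ∈ G.cut S e
      · exact not_le_of_opt_other (opt_gameOn.2 ⟨f, hfe, hfc, rfl⟩) ((ih' f hf).trans h)
      -- An opposing edge `f` that falls when `e` is cut does not support `e`. Cutting `f` and then
      -- `e` leaves the same as cutting `e` alone, so `G.cut S e` is an option of `p` after the cut
      -- of `f`.
      · have hef : e ≠ f := fun h => hc.not_other (hG e) (h ▸ hfc)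
        have hef' := (mem_cut_or_mem_cut hS he hf hef).resolve_right hfe
        have heq : G.cut S e = G.cut (G.cut S f) e := by
          rw [cut_comm, cut_eq_self (grounded_cut S e) hfe]
        rw [heq] at h
        exact not_le_of_opt (opt_gameOn.2 ⟨e, hef', hc, rfl⟩) h

theorem finite_setOf_opt_gameOn (p : Player) (S : Finset G.E) :
    {v | ∃ K, Opt p (G.gameOn S) K ∧ K.value = v}.Finite := by
  refine (Set.finite_range fun e : G.E => (G.gameOn (G.cut S e)).value).subset ?_
  rintro v ⟨K, hK, rfl⟩
  obtain ⟨e, -, -, rfl⟩ := opt_gameOn.1 hK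
  exact ⟨e, rfl⟩

/-- By `gameOn_cut_le` a left option is at most the position itself, so a right option of no greater
value would be at most the position too, which is impossible for a right option. -/
theorem numeric_gameOn (hG : G.IsRedBlue) {S : Finset G.E} (hS : G.grounded S = S) :
    Numeric (G.gameOn S) := by
  induction hn : S.card using Nat.strong_induction_on generalizing S with
  | _ n ih =>
    subst hn
    have ih' : ∀ e ∈ S, Numeric (G.gameOn (G.cut S e)) := fun e he =>
      ih _ (card_cut_lt he) (grounded_cut S e) rfl
    refine .intro _ (value_spec (exists_isSimplestBetween (finite_setOf_opt_gameOn _ S)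
      (finite_setOf_opt_gameOn _ S) ?_)) ?_
    · rintro _ ⟨K, hK, rfl⟩ _ ⟨K', hK', rfl⟩
      obtain ⟨e, he, hec, rfl⟩ := opt_gameOn.1 hK
      obtain ⟨f, hf, hfc, rfl⟩ := opt_gameOn.1 hK'
      have h := (ih' f hf).le_iff (p := .left) (ih' e he)
      by_contra hlt
      rw [not_lt] at hlt
      exact not_le_of_opt_other (p := .left) hK'
        ((h.2 hlt).trans (gameOn_cut_le (p := .left) hG hS he hec))
    · intro p K hK
      obtain ⟨e, he, -, rfl⟩ := opt_gameOn.1 hK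
      exact ih' e he

theorem numeric_game (hG : G.IsRedBlue) : Numeric G.game := numeric_gameOn hG (grounded_grounded _)

/-! ### Disjunctive sums of positions -/

theorem exists_of_sym2_map_eq {α β : Type} {f : α → β} {z : Sym2 α} {u w : β}
    (h : z.map f = s(u, w)) : ∃ a b, z = s(a, b) ∧ f a = u ∧ f b = w := by
  induction z using Sym2.ind with
  | _ a b =>
    rcases Sym2.eq_iff.1 h with ⟨h₁, h₂⟩ | ⟨h₁, h₂⟩
    · exact ⟨a, b, rfl, h₁, h₂⟩
    · exact ⟨b, a, Sym2.eq_swap, h₂, h₁⟩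

theorem reached_add {S : Finset G.E} {T : Finset H.E} {v : (G + H).V} :
    (G + H).Reached (S.disjSum T) v ↔ Sum.elim (G.Reached S) (H.Reached T) v := by
  constructor
  · intro h
    induction h with
    | ground w hw =>
      rcases hw with ⟨u, hu, rfl⟩ | ⟨u, hu, rfl⟩
      · exact .ground u hu
      · exact .ground u hu
    | step e he u w h _ ih =>
      rcases e with e | e
      · obtain ⟨a, b, hab, rfl, rfl⟩ := exists_of_sym2_map_eq (z := G.ends e) (f := Sum.inl) h
        exact .step e (Finset.inl_mem_disjSum.1 he) a b hab ih
      · obtain ⟨a, b, hab, rfl, rfl⟩ := exists_of_sym2_map_eq (z := H.ends e) (f := Sum.inr) h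
        exact .step e (Finset.inr_mem_disjSum.1 he) a b hab ih
  · rcases v with v | v
    · intro h
      replace h : G.Reached S v := h
      induction h with
      | ground v hv => exact .ground _ (.inl ⟨v, hv, rfl⟩)
      | step e he v w h _ ih =>
        exact Reached.step (G := G + H) (S := S.disjSum T) (Sum.inl e)
          (Finset.inl_mem_disjSum.2 he) (Sum.inl v) (Sum.inl w) (congrArg (Sym2.map Sum.inl) h) ih
    · intro h
      replace h : H.Reached T v := h
      induction h with
      | ground v hv => exact .ground _ (.inr ⟨v, hv, rfl⟩)
      | step e he v w h _ ih =>
        exact Reached.step (G := G + H) (S := S.disjSum T) (Sum.inr e)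
          (Finset.inr_mem_disjSum.2 he) (Sum.inr v) (Sum.inr w) (congrArg (Sym2.map Sum.inr) h) ih

theorem grounded_add (S : Finset G.E) (T : Finset H.E) :
    (G + H).grounded (S.disjSum T) = (G.grounded S).disjSum (H.grounded T) := by
  ext e
  rw [mem_grounded]
  rcases e with e | e
  · rw [Finset.inl_mem_disjSum, Finset.inl_mem_disjSum, mem_grounded]
    refine and_congr_right fun _ => ⟨?_, ?_⟩
    · rintro ⟨v, hv, hr⟩
      obtain ⟨a, ha, rfl⟩ := Sym2.mem_map.1 (show v ∈ (G.ends e).map Sum.inl from hv)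
      exact ⟨a, ha, reached_add.1 hr⟩
    · rintro ⟨a, ha, hr⟩
      exact ⟨Sum.inl a, Sym2.mem_map.2 ⟨a, ha, rfl⟩, reached_add.2 hr⟩
  · rw [Finset.inr_mem_disjSum, Finset.inr_mem_disjSum, mem_grounded]
    refine and_congr_right fun _ => ⟨?_, ?_⟩
    · rintro ⟨v, hv, hr⟩
      obtain ⟨a, ha, rfl⟩ := Sym2.mem_map.1 (show v ∈ (H.ends e).map Sum.inr from hv)
      exact ⟨a, ha, reached_add.1 hr⟩
    · rintro ⟨a, ha, hr⟩
      exact ⟨Sum.inr a, Sym2.mem_map.2 ⟨a, ha, rfl⟩, reached_add.2 hr⟩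

theorem erase_inl_disjSum {α β : Type} [DecidableEq α] [DecidableEq (α ⊕ β)] (S : Finset α) (T : Finset β) (a : α) :
    (S.disjSum T).erase (Sum.inl a) = (S.erase a).disjSum T := by
  ext x
  rcases x with x | x <;> simp

theorem erase_inr_disjSum {α β : Type} [DecidableEq β] [DecidableEq (α ⊕ β)] (S : Finset α) (T : Finset β) (b : β) :
    (S.disjSum T).erase (Sum.inr b) = S.disjSum (T.erase b) := by
  ext x
  rcases x with x | x <;> simp

theorem cut_add_inl {S : Finset G.E} {T : Finset H.E} (hT : H.grounded T = T) (e : G.E) :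
    (G + H).cut (S.disjSum T) (Sum.inl e) = (G.cut S e).disjSum T := by
  classical
  have h := grounded_add (S.erase e) T
  rw [hT] at h
  rw [cut, cut, ← h]
  congr 1
  exact @erase_inl_disjSum G.E H.E (fun _ _ => Classical.propDecidable _)
    (fun _ _ => Classical.propDecidable _) S T e

theorem cut_add_inr {S : Finset G.E} {T : Finset H.E} (hS : G.grounded S = S) (e : H.E) :
    (G + H).cut (S.disjSum T) (Sum.inr e) = S.disjSum (H.cut T e) := by
  classical
  have h := grounded_add S (T.erase e)
  rw [hS] at h
  rw [cut, cut, ← h]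
  congr 1
  exact @erase_inr_disjSum G.E H.E (fun _ _ => Classical.propDecidable _)
    (fun _ _ => Classical.propDecidable _) S T e

theorem bisim_gameOn_add {S : Finset G.E} {T : Finset H.E} (hS : G.grounded S = S)
    (hT : H.grounded T = T) :
    Bisim ((G + H).gameOn (S.disjSum T)) (G.gameOn S + H.gameOn T) := by
  induction hn : S.card + T.card using Nat.strong_induction_on generalizing S T with
  | _ n ih =>
    subst hn
    have h₁ : ∀ e ∈ S, Bisim ((G + H).gameOn ((G + H).cut (S.disjSum T) (Sum.inl e)))
        (G.gameOn (G.cut S e) + H.gameOn T) := by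
      intro e he
      rw [cut_add_inl hT]
      exact ih _ (Nat.add_lt_add_right (card_cut_lt he) _) (grounded_cut S e) hT rfl
    have h₂ : ∀ e ∈ T, Bisim ((G + H).gameOn ((G + H).cut (S.disjSum T) (Sum.inr e)))
        (G.gameOn S + H.gameOn (H.cut T e)) := by
      intro e he
      rw [cut_add_inr hS]
      exact ih _ (Nat.add_lt_add_left (card_cut_lt he) _) hS (grounded_cut T e) rfl
    refine bisim_iff.2 fun p => ⟨fun X hX => ?_, fun X hX => ?_⟩
    · obtain ⟨e, he, hc, rfl⟩ := opt_gameOn.1 hX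
      rcases e with e | e
      · have he' := Finset.inl_mem_disjSum.1 he
        exact ⟨_, Opt.add_right (opt_gameOn.2 ⟨e, he', hc, rfl⟩) _, h₁ e he'⟩
      · have he' := Finset.inr_mem_disjSum.1 he
        exact ⟨_, Opt.add_left (opt_gameOn.2 ⟨e, he', hc, rfl⟩) _, h₂ e he'⟩
    · rcases opt_add.1 hX with ⟨Y, hY, rfl⟩ | ⟨Y, hY, rfl⟩
      · obtain ⟨e, he, hc, rfl⟩ := opt_gameOn.1 hY
        exact ⟨_, opt_gameOn.2 ⟨Sum.inl e, Finset.inl_mem_disjSum.2 he, hc, rfl⟩, h₁ e he⟩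
      · obtain ⟨e, he, hc, rfl⟩ := opt_gameOn.1 hY
        exact ⟨_, opt_gameOn.2 ⟨Sum.inr e, Finset.inr_mem_disjSum.2 he, hc, rfl⟩, h₂ e he⟩

theorem bisim_game_add (G H : Hackenbush) : Bisim (G + H).game (G.game + H.game) := by
  have h := grounded_add (G := G) (H := H) Finset.univ Finset.univ
  rw [Finset.univ_disjSum_univ] at h
  have h' := bisim_gameOn_add (G := G) (H := H) (grounded_grounded Finset.univ)
    (grounded_grounded Finset.univ)
  rw [← h] at h'
  exact h'

theorem bisim_game_zero : Bisim (0 : Hackenbush).game 0 := by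
  refine bisim_iff.2 fun p => ⟨fun X hX => ?_, fun X hX => absurd hX not_opt_zero⟩
  obtain ⟨e, -⟩ := opt_gameOn.1 hX
  exact Empty.elim e

/-! ### Flowers -/

section Stem

variable {n : ℕ} {B : Hackenbush}

/-- A vertex of the stem. -/
def stemVertex (j : Fin (n + 1)) : (stemWith n B).V := Sum.inl j

open Classical in
/-- The vertex of the flower that corresponds to a vertex of the blossom. -/
noncomputable def blossomVertex (n : ℕ) (v : B.V) : (stemWith n B).V :=
  if v ∈ B.ground then stemVertex (Fin.last n) else Sum.inr v

/-- An edge of the stem. -/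
def stemEdge (i : Fin n) : (stemWith n B).E := Sum.inl i

/-- The edge of the flower that corresponds to an edge of the blossom. -/
def blossomEdge (n : ℕ) (e : B.E) : (stemWith n B).E := Sum.inr e

/-- The set of edges of the flower given by edges of the stem and edges of the blossom. -/
def flowerEdges (S : Finset (Fin n)) (T : Finset B.E) : Finset (stemWith n B).E := S.disjSum T

/-- The lowest `m` edges of a stem. -/
def lowerStem (n m : ℕ) (B : Hackenbush) : Finset (stemWith n B).E :=
  flowerEdges (Finset.univ.filter fun j : Fin n => (j : ℕ) < m) ∅

theorem edge_cases (e : (stemWith n B).E) :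
    (∃ i, e = stemEdge i) ∨ ∃ b, e = blossomEdge n b := by
  rcases e with i | b
  · exact .inl ⟨i, rfl⟩
  · exact .inr ⟨b, rfl⟩

@[simp] theorem stemEdge_mem {S : Finset (Fin n)} {T : Finset B.E} {i : Fin n} :
    stemEdge i ∈ flowerEdges S T ↔ i ∈ S := Finset.inl_mem_disjSum

@[simp] theorem blossomEdge_mem {S : Finset (Fin n)} {T : Finset B.E} {e : B.E} :
    blossomEdge n e ∈ flowerEdges S T ↔ e ∈ T := Finset.inr_mem_disjSum

@[simp] theorem stemEdge_inj {i j : Fin n} :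
    (stemEdge i : (stemWith n B).E) = stemEdge j ↔ i = j := Sum.inl_injective.eq_iff

@[simp] theorem blossomEdge_inj {e f : B.E} : blossomEdge n e = blossomEdge n f ↔ e = f :=
  Sum.inr_injective.eq_iff

@[simp] theorem stemEdge_ne_blossomEdge {i : Fin n} {e : B.E} : stemEdge i ≠ blossomEdge n e :=
  Sum.inl_ne_inr

@[simp] theorem blossomEdge_ne_stemEdge {i : Fin n} {e : B.E} : blossomEdge n e ≠ stemEdge i :=
  Sum.inr_ne_inl

theorem univ_flowerEdges :
    (flowerEdges Finset.univ Finset.univ : Finset (stemWith n B).E) = Finset.univ :=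
  Finset.univ_disjSum_univ

theorem ends_blossomEdge (e : B.E) :
    (stemWith n B).ends (blossomEdge n e) = (B.ends e).map (blossomVertex n) := rfl

theorem ends_stemEdge (i : Fin n) :
    (stemWith n B).ends (stemEdge i) = s(stemVertex i.castSucc, stemVertex i.succ) := rfl

theorem blossomVertex_of_mem {v : B.V} (hv : v ∈ B.ground) :
    blossomVertex n v = stemVertex (Fin.last n) := if_pos hv

/-- The predicate on the vertices of a flower given by predicates on the vertices of the stem and
of the blossom. -/
def vertexPred (P : Fin (n + 1) → Prop) (Q : B.V → Prop) : (stemWith n B).V → Prop := Sum.elim P Q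

theorem vertexPred_stemVertex {P : Fin (n + 1) → Prop} {Q : B.V → Prop} {j : Fin (n + 1)} :
    vertexPred P Q (stemVertex j) ↔ P j := Iff.rfl

theorem vertexPred_blossomVertex {P : Fin (n + 1) → Prop} {Q : B.V → Prop} {v : B.V}
    (hv : v ∉ B.ground) : vertexPred P Q (blossomVertex n v) ↔ Q v := by
  rw [show blossomVertex n v = (Sum.inr v : Fin (n + 1) ⊕ B.V) from if_neg hv]
  rfl

theorem reached_stemVertex {S : Finset (Fin n)} {T : Finset B.E} {m : ℕ}
    (h : ∀ i : Fin n, (i : ℕ) < m → i ∈ S) (j : Fin (n + 1)) (hj : (j : ℕ) ≤ m) :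
    (stemWith n B).Reached (flowerEdges S T) (stemVertex j) := by
  induction j using Fin.induction with
  | zero => exact .ground _ rfl
  | succ i ih =>
    rw [Fin.val_succ] at hj
    refine .step (stemEdge i) (stemEdge_mem.2 (h i hj)) _ _ (ends_stemEdge i) (ih ?_)
    rw [Fin.val_castSucc]
    omega

/-- With the whole stem present its top is connected to the ground, so it serves as the ground of
the blossom. Paths through the stem give the blossom nothing else. -/
theorem reached_blossomVertex {T : Finset B.E} {v : B.V} :
    (stemWith n B).Reached (flowerEdges Finset.univ T) (blossomVertex n v) ↔ B.Reached T v := by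
  constructor
  · have key : ∀ a, vertexPred (fun _ => True) (B.Reached T) (blossomVertex n a) ↔
        B.Reached T a := by
      intro a
      by_cases ha : a ∈ B.ground
      · rw [blossomVertex_of_mem ha, vertexPred_stemVertex, true_iff]
        exact .ground a ha
      · exact vertexPred_blossomVertex ha
    intro h
    rw [← key]
    generalize blossomVertex n v = w at h
    induction h with
    | ground w hw =>
      rw [Set.mem_singleton_iff.1 hw]
      trivial
    | step e he u w h _ ih =>
      rcases edge_cases e with ⟨i, rfl⟩ | ⟨e, rfl⟩
      · rw [ends_stemEdge] at h
        rcases Sym2.eq_iff.1 h with ⟨-, rfl⟩ | ⟨rfl, -⟩ <;> trivial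
      · rw [ends_blossomEdge] at h
        obtain ⟨a, b, hab, rfl, rfl⟩ := exists_of_sym2_map_eq h
        rw [key] at ih ⊢
        exact .step e (blossomEdge_mem.1 he) a b hab ih
  · intro h
    induction h with
    | ground v hv =>
      rw [blossomVertex_of_mem hv]
      exact reached_stemVertex (m := n) (fun i _ => Finset.mem_univ i) _ le_rfl
    | step e he v w h _ ih =>
      refine .step (blossomEdge n e) (blossomEdge_mem.2 he) _ _ ?_ ih
      rw [ends_blossomEdge, h, Sym2.map_mk]

theorem grounded_flowerEdges (T : Finset B.E) :
    (stemWith n B).grounded (flowerEdges Finset.univ T) =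
      flowerEdges Finset.univ (B.grounded T) := by
  ext e
  rw [mem_grounded]
  rcases edge_cases e with ⟨i, rfl⟩ | ⟨e, rfl⟩
  · simp only [stemEdge_mem, Finset.mem_univ, true_and, iff_true]
    refine ⟨stemVertex i.castSucc, by simp [ends_stemEdge], ?_⟩
    exact reached_stemVertex (m := n) (fun i _ => Finset.mem_univ i) _ i.castSucc.is_le
  · rw [blossomEdge_mem, blossomEdge_mem, mem_grounded, ends_blossomEdge]
    refine and_congr_right fun _ => ⟨?_, ?_⟩
    · rintro ⟨v, hv, hr⟩
      obtain ⟨a, ha, rfl⟩ := Sym2.mem_map.1 hv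
      exact ⟨a, ha, reached_blossomVertex.1 hr⟩
    · rintro ⟨a, ha, hr⟩
      exact ⟨_, Sym2.mem_map.2 ⟨a, ha, rfl⟩, reached_blossomVertex.2 hr⟩

/-- Everything above a cut in the stem falls off. -/
theorem grounded_flowerEdges_of_notMem {S : Finset (Fin n)} {T : Finset B.E} {i : Fin n}
    (hi : i ∉ S) (hS : ∀ j < i, j ∈ S) :
    (stemWith n B).grounded (flowerEdges S T) = lowerStem n i B := by
  -- The invariant "on the stem, at height at most `i`" holds at the ground and cannot be left
  -- without edge `i`. It fails at every vertex of the blossom, including its ground, which sits at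
  -- height `n > i`.
  have hfall : ∀ a : B.V, ¬ vertexPred (fun j : Fin (n + 1) => (j : ℕ) ≤ i) (fun _ => False)
      (blossomVertex n a) := by
    intro a
    by_cases ha : a ∈ B.ground
    · rw [blossomVertex_of_mem ha, vertexPred_stemVertex, Fin.val_last, not_le]
      exact i.2
    · rw [vertexPred_blossomVertex ha]
      exact id
  have key : ∀ v, (stemWith n B).Reached (flowerEdges S T) v →
      vertexPred (fun j : Fin (n + 1) => (j : ℕ) ≤ i) (fun _ => False) v := by
    intro v h
    induction h with
    | ground w hw =>
      rw [Set.mem_singleton_iff.1 hw]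
      exact Nat.zero_le _
    | step e he u w h _ ih =>
      rcases edge_cases e with ⟨j, rfl⟩ | ⟨e, rfl⟩
      · have hj : (j : ℕ) ≠ i := fun h => hi (Fin.ext h ▸ stemEdge_mem.1 he)
        rw [ends_stemEdge] at h
        rcases Sym2.eq_iff.1 h with ⟨rfl, rfl⟩ | ⟨rfl, rfl⟩
        · rw [vertexPred_stemVertex, Fin.val_castSucc] at ih
          rw [vertexPred_stemVertex, Fin.val_succ]
          omega
        · rw [vertexPred_stemVertex, Fin.val_succ] at ih
          rw [vertexPred_stemVertex, Fin.val_castSucc]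
          omega
      · rw [ends_blossomEdge] at h
        obtain ⟨a, b, hab, rfl, rfl⟩ := exists_of_sym2_map_eq h
        exact absurd ih (hfall a)
  ext e
  rw [mem_grounded, lowerStem]
  rcases edge_cases e with ⟨j, rfl⟩ | ⟨e, rfl⟩
  · simp only [stemEdge_mem, Finset.mem_filter, Finset.mem_univ, true_and]
    constructor
    · rintro ⟨hj, v, hv, hr⟩
      have hne : (j : ℕ) ≠ i := fun h => hi (Fin.ext h ▸ hj)
      have := key v hr
      rw [ends_stemEdge, Sym2.mem_iff] at hv
      rcases hv with rfl | rfl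
      · rw [vertexPred_stemVertex, Fin.val_castSucc] at this
        omega
      · rw [vertexPred_stemVertex, Fin.val_succ] at this
        omega
    · intro hj
      refine ⟨hS j hj, stemVertex j.castSucc, by simp [ends_stemEdge], ?_⟩
      exact reached_stemVertex (m := i) (fun k hk => hS k hk) _ hj.le
  · simp only [blossomEdge_mem, Finset.notMem_empty, iff_false]
    rintro ⟨-, v, hv, hr⟩
    rw [ends_blossomEdge] at hv
    obtain ⟨a, -, rfl⟩ := Sym2.mem_map.1 hv
    exact hfall a (key _ hr)

open Classical in
theorem erase_stemEdge (S : Finset (Fin n)) (T : Finset B.E) (i : Fin n) :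
    (flowerEdges S T).erase (stemEdge i) = flowerEdges (S.erase i) T := by
  ext e
  rcases edge_cases e with ⟨j, rfl⟩ | ⟨e, rfl⟩ <;> simp

open Classical in
theorem erase_blossomEdge (S : Finset (Fin n)) (T : Finset B.E) (e : B.E) :
    (flowerEdges S T).erase (blossomEdge n e) = flowerEdges S (T.erase e) := by
  ext f
  rcases edge_cases f with ⟨j, rfl⟩ | ⟨f, rfl⟩ <;> simp

theorem cut_lowerStem {m : ℕ} {i : Fin n} (hi : (i : ℕ) < m) :
    (stemWith n B).cut (lowerStem n m B) (stemEdge i) = lowerStem n i B := by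
  rw [cut, lowerStem, erase_stemEdge]
  refine grounded_flowerEdges_of_notMem (by simp) fun j hj => ?_
  have hj' : (j : ℕ) < i := hj
  simp only [Finset.mem_erase, Finset.mem_filter, Finset.mem_univ, true_and]
  exact ⟨hj.ne, hj'.trans hi⟩

theorem cut_stemEdge (T : Finset B.E) (i : Fin n) :
    (stemWith n B).cut (flowerEdges Finset.univ T) (stemEdge i) = lowerStem n i B := by
  rw [cut, erase_stemEdge]
  exact grounded_flowerEdges_of_notMem (by simp) fun j hj => by simp [hj.ne]

theorem cut_blossomEdge (T : Finset B.E) (e : B.E) :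
    (stemWith n B).cut (flowerEdges Finset.univ T) (blossomEdge n e) =
      flowerEdges Finset.univ (B.cut T e) := by
  rw [cut, cut, erase_blossomEdge, grounded_flowerEdges]

theorem canCut_stemEdge (p : Player) (i : Fin n) :
    p.CanCut ((stemWith n B).color (stemEdge i)) := p.canCut_green

theorem bisim_gameOn_lowerStem {m : ℕ} (hm : m ≤ n) :
    Bisim ((stemWith n B).gameOn (lowerStem n m B)) (nim m) := by
  induction m using Nat.strong_induction_on with
  | _ m ih =>
    refine bisim_iff.2 fun p => ⟨fun X hX => ?_, fun X hX => ?_⟩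
    · obtain ⟨e, he, hc, rfl⟩ := opt_gameOn.1 hX
      rw [lowerStem] at he
      rcases edge_cases e with ⟨i, rfl⟩ | ⟨e, rfl⟩
      · have hi : (i : ℕ) < m := by simpa using he
        refine ⟨_, opt_nim_of_lt p hi, ?_⟩
        rw [cut_lowerStem hi]
        exact ih _ hi i.2.le
      · simp at he
    · obtain ⟨k, hk, rfl⟩ := opt_nim.1 hX
      have hi : ((⟨k, hk.trans_le hm⟩ : Fin n) : ℕ) < m := hk
      refine ⟨_, opt_gameOn.2 ⟨stemEdge ⟨k, hk.trans_le hm⟩, by simpa [lowerStem] using hk,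
        canCut_stemEdge _ _, rfl⟩, ?_⟩
      rw [cut_lowerStem hi]
      exact ih _ hk (hk.le.trans hm)

theorem bisim_gameOn_flowerEdges (T : Finset B.E) :
    Bisim ((stemWith n B).gameOn (flowerEdges Finset.univ T)) (flower n (B.gameOn T)) := by
  induction hn : T.card using Nat.strong_induction_on generalizing T with
  | _ c ih =>
    subst hn
    have h₁ : ∀ i : Fin n, Bisim ((stemWith n B).gameOn
        ((stemWith n B).cut (flowerEdges Finset.univ T) (stemEdge i))) (nim i) := by
      intro i
      rw [cut_stemEdge]
      exact bisim_gameOn_lowerStem i.2.le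
    have h₂ : ∀ e ∈ T, Bisim ((stemWith n B).gameOn
        ((stemWith n B).cut (flowerEdges Finset.univ T) (blossomEdge n e)))
          (flower n (B.gameOn (B.cut T e))) := by
      intro e he
      rw [cut_blossomEdge]
      exact ih _ (card_cut_lt he) _ rfl
    refine bisim_iff.2 fun p => ⟨fun X hX => ?_, fun X hX => ?_⟩
    · obtain ⟨e, he, hc, rfl⟩ := opt_gameOn.1 hX
      rcases edge_cases e with ⟨i, rfl⟩ | ⟨e, rfl⟩
      · exact ⟨_, opt_flower_cut p _ i.2, h₁ i⟩
      · have he' := blossomEdge_mem.1 he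
        exact ⟨_, Opt.flower (opt_gameOn.2 ⟨e, he', hc, rfl⟩) n, h₂ e he'⟩
    · rcases opt_flower.1 hX with ⟨k, hk, rfl⟩ | ⟨Y, hY, rfl⟩
      · exact ⟨_, opt_gameOn.2 ⟨stemEdge ⟨k, hk⟩, by simp, canCut_stemEdge _ _, rfl⟩,
          h₁ ⟨k, hk⟩⟩
      · obtain ⟨e, he, hc, rfl⟩ := opt_gameOn.1 hY
        exact ⟨_, opt_gameOn.2 ⟨blossomEdge n e, blossomEdge_mem.2 he, hc, rfl⟩, h₂ e he⟩

theorem bisim_game_stemWith (n : ℕ) (B : Hackenbush) :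
    Bisim (stemWith n B).game (flower n B.game) := by
  rw [game, ← univ_flowerEdges, grounded_flowerEdges]
  exact bisim_gameOn_flowerEdges _

end Stem

end Hackenbush

/-! ### Bitwise exclusive or -/

/-- If `m ^^^ a < m`, that number itself serves. If it is larger, `m - 1` serves: as `m` is odd, it
differs from `m` only in the lowest bit. -/
theorem Nat.exists_lt_le_xor_of_odd {m a : ℕ} (hm : Odd m) (ha : a ≠ 0) :
    ∃ k < m, m ≤ k ^^^ a := by
  rcases lt_trichotomy (m ^^^ a) m with h | h | h
  · exact ⟨m ^^^ a, h, by rw [Nat.xor_assoc, Nat.xor_self, Nat.xor_zero]⟩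
  · exact absurd (Nat.xor_right_inj.1 (h.trans (Nat.xor_zero m).symm)) ha
  · obtain ⟨c, rfl⟩ := hm
    have h₁ : (2 * c + 1 ^^^ a) >>> 1 = c ^^^ a >>> 1 := by
      rw [Nat.shiftRight_xor_distrib]
      congr 1
      rw [Nat.shiftRight_one]
      omega
    have h₂ : (2 * c ^^^ a) >>> 1 = c ^^^ a >>> 1 := by
      rw [Nat.shiftRight_xor_distrib]
      congr 1
      rw [Nat.shiftRight_one]
      omega
    refine ⟨2 * c, by omega, ?_⟩
    -- If `a` has only its lowest bit, then `m ^^^ a` cannot exceed the odd number `m`. Otherwise `m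
    -- ^^^ a` already exceeds `m` above the lowest bit, and `2 * c ^^^ a` has the same higher bits.
    by_cases ha' : a >>> 1 = 0
    · rw [ha', Nat.xor_zero, Nat.shiftRight_one] at h₁
      omega
    · have hne : c ^^^ a >>> 1 ≠ c := fun h' =>
        ha' (Nat.xor_right_inj.1 (h'.trans (Nat.xor_zero c).symm))
      rw [← h₁, Nat.shiftRight_one] at hne
      rw [← h₁, Nat.shiftRight_one, Nat.shiftRight_one] at h₂
      omega

/-- Discarding the lowest `α` bits, which commutes with exclusive or, reduces to the odd number `m`
and a nonzero `a`. -/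
theorem Nat.exists_lt_le_xor {m a α : ℕ} (hm : Odd m) (ha : 2 ^ α ≤ a) :
    ∃ k < 2 ^ α * m, 2 ^ α * m ≤ k ^^^ a := by
  have hpos : 0 < 2 ^ α := by positivity
  have ha' : a >>> α ≠ 0 := by
    rw [Nat.shiftRight_eq_div_pow]
    exact (Nat.div_pos ha hpos).ne'
  obtain ⟨k, hk, hle⟩ := Nat.exists_lt_le_xor_of_odd hm ha'
  refine ⟨2 ^ α * k, Nat.mul_lt_mul_of_pos_left hk hpos, ?_⟩
  have h₁ : (2 ^ α * k) >>> α = k := by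
    rw [Nat.shiftRight_eq_div_pow, Nat.mul_div_cancel_left _ hpos]
  rw [← h₁, ← Nat.shiftRight_xor_distrib, Nat.shiftRight_eq_div_pow,
    Nat.le_div_iff_mul_le hpos] at hle
  rwa [mul_comm]

/-- A number below `2 ^ α` alters only the lowest `α` bits, so the quotient of `k` by `2 ^ α` stays
below `m`. -/
theorem Nat.xor_lt_of_lt_two_pow {m a α k : ℕ} (ha : a < 2 ^ α) (hk : k < 2 ^ α * m) :
    k ^^^ a < 2 ^ α * m := by
  have hpos : 0 < 2 ^ α := by positivity
  have h : (k ^^^ a) / 2 ^ α = k / 2 ^ α := by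
    rw [← Nat.shiftRight_eq_div_pow, Nat.shiftRight_xor_distrib, Nat.shiftRight_eq_div_pow,
      Nat.shiftRight_eq_div_pow, Nat.div_eq_of_lt ha, Nat.xor_zero]
  rw [mul_comm, ← Nat.div_lt_iff_lt_mul hpos] at hk ⊢
  rwa [h]

namespace CGame

/-! ### Two flowers of the same height and a nim heap -/

variable {p : Player} {n a : ℕ} {X Y : CGame}

theorem Numeric.winsNormal_flower_add_iff (hX : Numeric X) (hY : Numeric Y) :
    (flower n X + flower n Y).WinsNormal p ↔ 0 < valueFor p X + valueFor p Y := by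
  rw [winsNormal_flower_add_flower, hX.winsNormal_add_iff hY]

theorem eqv_add_nim_zero (G : CGame) : Eqv (G + nim 0) G :=
  ((Eqv.refl G).add bisim_nim_zero.eqv).trans (eqv_add_zero G)

theorem Numeric.not_winsNormal_other_flower_add (hX : Numeric X) (hY : Numeric Y)
    (h : 0 ≤ valueFor p X + valueFor p Y) :
    ¬ (flower n X + flower n Y + nim 0).WinsNormal p.other := by
  rw [(eqv_add_nim_zero _).winsNormal_iff, hX.winsNormal_flower_add_iff hY, valueFor_other,
    valueFor_other]
  linarith

theorem Numeric.winsNormal_of_nonneg (hX : Numeric X) (hY : Numeric Y) (ha : a ≠ 0)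
    (h : 0 ≤ valueFor p X + valueFor p Y) : (flower n X + flower n Y + nim a).WinsNormal p :=
  winsNormal_of_opt ((opt_nim_of_lt p (Nat.pos_of_ne_zero ha)).add_left _)
    (hX.not_winsNormal_other_flower_add hY h)

theorem Numeric.winsNormal_of_pos (hX : Numeric X) (hY : Numeric Y) (a : ℕ)
    (h : 0 < valueFor p X + valueFor p Y) : (flower n X + flower n Y + nim a).WinsNormal p := by
  by_cases ha : a = 0
  · rwa [ha, (eqv_add_nim_zero _).winsNormal_iff, hX.winsNormal_flower_add_iff hY]
  · exact hX.winsNormal_of_nonneg hY ha h.le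

theorem not_winsNormal_three_nim (k a : ℕ) : ¬ (nim k + nim (k ^^^ a) + nim a).WinsNormal p := by
  have h := (nim_add_nim k (k ^^^ a)).add (.refl (nim a))
  rw [← Nat.xor_assoc, Nat.xor_self, Nat.zero_xor] at h
  rw [h.winsNormal_iff]
  exact not_winsNormal_nim_add_self a p

/-- If cutting one flower cannot create a nim sum as large as the height, then the player who is
ahead wins when moving second. -/
theorem Numeric.not_winsNormal_other_of_pos (hX : Numeric X) (hY : Numeric Y)
    (ha : ∀ k < n, k ^^^ a < n) (h : 0 < valueFor p X + valueFor p Y) :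
    ¬ (flower n X + flower n Y + nim a).WinsNormal p.other := by
  by_cases ha0 : a = 0
  · rw [ha0]
    exact hX.not_winsNormal_other_flower_add hY h.le
  intro hw
  obtain ⟨K, hK, hw⟩ := CGame.winsNormal_iff.1 hw
  rw [Player.other_other] at hw
  refine hw ?_
  -- A stem cut to `k` is answered by cutting the other stem to `k ^^^ a`, which `ha` permits. A
  -- blossom move by the opponent only increases the lead of `p`, and after a heap move `p` is ahead
  -- and to move.
  rcases opt_add.1 hK with ⟨D, hD, rfl⟩ | ⟨N, hN, rfl⟩
  · rcases opt_add.1 hD with ⟨Z, hZ, rfl⟩ | ⟨Z, hZ, rfl⟩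
    · rcases opt_flower.1 hZ with ⟨k, hk, rfl⟩ | ⟨W, hW, rfl⟩
      · exact winsNormal_of_opt (((opt_flower_cut p Y (ha k hk)).add_left _).add_right _)
          (not_winsNormal_three_nim k a)
      · exact (hX.opt hW).winsNormal_of_pos hY a (by linarith [hX.lt_valueFor hW])
    · rcases opt_flower.1 hZ with ⟨k, hk, rfl⟩ | ⟨W, hW, rfl⟩
      · refine winsNormal_of_opt (((opt_flower_cut p X (ha k hk)).add_right _).add_right _) ?_
        rw [((eqv_add_comm _ _).add (.refl _)).winsNormal_iff]
        exact not_winsNormal_three_nim k a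
      · exact hX.winsNormal_of_pos (hY.opt hW) a (by linarith [hY.lt_valueFor hW])
  · obtain ⟨k, -, rfl⟩ := opt_nim.1 hN
    exact hX.winsNormal_of_pos hY k h

/-- A player wins by cutting the other flower so that the nim sum becomes at least the height of
the flower that is good for this player. -/
theorem Numeric.winsNormal_of_le_xor (hX : Numeric X) (h : 0 < valueFor p X) {k : ℕ} (hk : k < n)
    (hle : n ≤ k ^^^ a) : (flower n X + flower n Y + nim a).WinsNormal p := by
  refine winsNormal_of_opt (((opt_flower_cut p Y hk).add_left _).add_right _) ?_
  rw [((eqv_add_assoc _ _ _).trans ((Eqv.refl _).add (nim_add_nim k a))).winsNormal_iff]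
  refine not_winsNormal_flower_add_nim (hX.winsNormal_iff.2 h) ?_ (fun X' hX' => ?_) hle
  · rw [hX.winsNormal_other_iff]
    exact h.le.not_gt
  · rw [(hX.opt hX').winsNormal_other_iff]
    linarith [hX.lt_valueFor hX']

end CGame

/-! ### From Generalized Flowers to sums of abstract flowers -/

namespace GeneralizedFlower

open CGame

/-- The height and the blossom of a Generalized Flower. -/
noncomputable def toPair (f : GeneralizedFlower) : ℕ × CGame := (f.height, f.blossom.game)

theorem bisim_game_position (f : GeneralizedFlower) :
    Bisim f.position.game (flower f.toPair.1 f.toPair.2) :=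
  Hackenbush.bisim_game_stemWith f.height f.blossom

theorem numeric_blossom (f : GeneralizedFlower) : Numeric f.blossom.game :=
  Hackenbush.numeric_game f.blossom_redBlue

theorem bisim_game_sum (A : List GeneralizedFlower) :
    Bisim (A.map position).sum.game (flowers (A.map toPair)) := by
  induction A with
  | nil => exact Hackenbush.bisim_game_zero
  | cons f A ih =>
    rw [List.map_cons, List.sum_cons, List.map_cons, flowers_cons]
    exact (Hackenbush.bisim_game_add _ _).trans (f.bisim_game_position.add ih)

theorem isFlowerList_map (A : List GeneralizedFlower) : IsFlowerList (A.map toPair) := by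
  intro c hc
  obtain ⟨f, -, rfl⟩ := List.mem_map.1 hc
  exact ⟨f.numeric_blossom, fun h => absurd h f.height_pos.ne'⟩

/-- Stalks carrying blossoms of value zero amount to a nim heap. -/
theorem nim_eqv_flowers {A : List GeneralizedFlower} (hA : ∀ f ∈ A, f.blossomValue = 0) :
    Eqv (nim (nimSum (A.map height))) (flowers (A.map toPair)) := by
  intro p
  have h : ∀ c ∈ A.map toPair, Le p 0 c.2 := by
    intro c hc
    obtain ⟨f, hf, rfl⟩ := List.mem_map.1 hc
    have hv : f.blossom.game.value = 0 := hA f hf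
    refine (numeric_zero.le_iff f.numeric_blossom).2 ?_
    cases p <;> simp [valueFor, hv]
  have := nim_le_flowers h
  rwa [List.map_map] at this

end GeneralizedFlower

/-! ### The outcomes of the sum -/

theorem proposition4p8 (u v : GeneralizedFlower) (A : List GeneralizedFlower)
    (h : ℕ) (hu : u.height = h) (hv : v.height = h) (hh : 2 ≤ h)
    (x y : ℚ) (hx : u.blossomValue = x) (hy : v.blossomValue = -y) (hx0 : 0 < x) (hy0 : 0 < y)
    (hA : ∀ f ∈ A, f.blossomValue = 0)
    (a : ℕ) (ha : a = nimSum (A.map GeneralizedFlower.height))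
    (α : ℕ) (hα : IsGreatest {k : ℕ | 2 ^ k ∣ h} α)
    (F : CGame)
    (hF : F = (u.position + v.position + (A.map GeneralizedFlower.position).sum).game) :
    F.normalOutcome = F.misereOutcome ∧
    ((2 ^ α ≤ a ∨ (a ≠ 0 ∧ a < 2 ^ α ∧ x = y)) → F.normalOutcome = .N) ∧
    (a = 0 ∧ x = y → F.normalOutcome = .P) ∧
    (a < 2 ^ α ∧ y < x → F.normalOutcome = .L) ∧
    (a < 2 ^ α ∧ x < y → F.normalOutcome = .R) := by
  subst hu ha hF
  have hX := u.numeric_blossom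
  have hY := v.numeric_blossom
  set X := u.blossom.game
  set Y := v.blossom.game
  set n := u.height
  set a := nimSum (A.map GeneralizedFlower.height)
  set F := (u.position + v.position + (A.map GeneralizedFlower.position).sum).game
  have hvx : X.value = x := hx
  have hvy : Y.value = -y := hy
  have hbisim : F.Bisim (CGame.flowers ((u :: v :: A).map GeneralizedFlower.toPair)) :=
    (Hackenbush.bisim_game_add _ _).trans ((((Hackenbush.bisim_game_add _ _).trans
      (u.bisim_game_position.add v.bisim_game_position)).add
        (GeneralizedFlower.bisim_game_sum A)).trans (CGame.bisim_add_assoc _ _ _))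
  have hnormal : ∀ p, F.WinsNormal p ↔
      (CGame.flower n X + CGame.flower n Y + CGame.nim a).WinsNormal p := by
    intro p
    rw [hbisim.winsNormal_iff]
    -- Replacing the stalks by one nim heap is only an equality in normal play, which suffices
    -- because misère play is reduced to normal play separately.
    have h := (CGame.eqv_add_assoc (CGame.flower n X) (CGame.flower n Y) _).symm.trans
      ((CGame.Eqv.refl _).add (GeneralizedFlower.nim_eqv_flowers hA).symm)
    rw [← h.winsNormal_iff]
    simp only [List.map_cons, CGame.flowers_cons, GeneralizedFlower.toPair, hv]
    rfl
  have hmisere : F.WinsMisere = F.WinsNormal := by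
    funext p
    rw [hbisim.winsMisere_iff, hbisim.winsNormal_iff]
    refine propext (CGame.winsMisere_flowers_iff_winsNormal
      (GeneralizedFlower.isFlowerList_map _) fun h => ?_)
    have : n ≤ 1 := h _ (List.mem_map_of_mem List.mem_cons_self)
    omega
  obtain ⟨m, hm⟩ := hα.1
  -- A factor 2 in `m` would contradict the maximality of `α`.
  have hodd : Odd m := by
    rw [← Nat.not_even_iff_odd]
    rintro ⟨c, rfl⟩
    have : α + 1 ≤ α := hα.2 ⟨c, by rw [hm]; ring⟩
    omega
  have hlt : a < 2 ^ α → ∀ k < n, k ^^^ a < n := by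
    intro h k hk
    rw [hm] at hk ⊢
    exact Nat.xor_lt_of_lt_two_pow h hk
  have hL : CGame.valueFor .left X + CGame.valueFor .left Y = x - y := by
    simp only [CGame.valueFor, hvx, hvy]
    ring
  have hR : CGame.valueFor .right X + CGame.valueFor .right Y = y - x := by
    simp only [CGame.valueFor, hvx, hvy]
    ring
  refine ⟨by rw [CGame.normalOutcome, CGame.misereOutcome, hmisere], ?_, ?_, ?_, ?_⟩ <;>
    rw [CGame.normalOutcome, Outcome.ofWins]
  · intro h
    suffices F.WinsNormal .left ∧ F.WinsNormal .right by rw [if_pos this.1, if_pos this.2]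
    rw [hnormal, hnormal]
    rcases h with h | ⟨h, -, rfl⟩
    -- The same `k` serves both players: each cuts the opposing stem to `k`. For Right the two
    -- flowers are first exchanged.
    · obtain ⟨k, hk, hle⟩ := Nat.exists_lt_le_xor hodd h
      rw [← hm] at hk hle
      refine ⟨hX.winsNormal_of_le_xor (by rwa [CGame.valueFor, hvx]) hk hle, ?_⟩
      rw [((CGame.eqv_add_comm _ _).add (.refl _)).winsNormal_iff]
      exact hY.winsNormal_of_le_xor (by rwa [CGame.valueFor, hvy, neg_neg]) hk hle
    · exact ⟨hX.winsNormal_of_nonneg hY h (by rw [hL, sub_self]),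
        hX.winsNormal_of_nonneg hY h (by rw [hR, sub_self])⟩
  · rintro ⟨h, rfl⟩
    have h₁ : ¬ F.WinsNormal .left := by
      rw [hnormal, h]
      exact hX.not_winsNormal_other_flower_add (p := .right) hY (by rw [hR, sub_self])
    have h₂ : ¬ F.WinsNormal .right := by
      rw [hnormal, h]
      exact hX.not_winsNormal_other_flower_add (p := .left) hY (by rw [hL, sub_self])
    rw [if_neg h₁, if_neg h₂]
  · rintro ⟨h, hxy⟩
    have hpos : 0 < CGame.valueFor .left X + CGame.valueFor .left Y := by rw [hL]; linarith
    have h₁ : F.WinsNormal .left := (hnormal _).2 (hX.winsNormal_of_pos hY a hpos)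
    have h₂ : ¬ F.WinsNormal .right := by
      rw [hnormal]
      exact hX.not_winsNormal_other_of_pos (p := .left) hY (hlt h) hpos
    rw [if_pos h₁, if_neg h₂]
  · rintro ⟨h, hxy⟩
    have hpos : 0 < CGame.valueFor .right X + CGame.valueFor .right Y := by rw [hR]; linarith
    have h₁ : F.WinsNormal .right := (hnormal _).2 (hX.winsNormal_of_pos hY a hpos)
    have h₂ : ¬ F.WinsNormal .left := by
      rw [hnormal]
      exact hX.not_winsNormal_other_of_pos (p := .right) hY (hlt h) hpos
    rw [if_neg h₂, if_pos h₁]
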